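/- Let $K$ be a field of arbitrary characteristic; all Lie algebras are over $K$, of arbitrary dimension. A Lie algebra $L$ is of type $FP_s$ if the trivial module $K$ over the universal enveloping algebra $\mathcal U(L)$ has a projective resolution $\cdots\to P_1\to P_0\to K\to 0$ with $P_i$ finitely generated for all $i\le s$. For $n\ge 1$, the homological $n$-$(n+1)$-$(n+2)$ conjecture over $K$ is the following assertion. Whenever $A\rightarrowtail L_1\overset{\pi_1}{\twoheadrightarrow} Q$ and $B\rightarrowtail L_2\overset{\pi_2}{\twoheadrightarrow} Q$ are short exact sequences of Lie algebras with $L_1$ and $L_2$ of type $FP_{n+1}$, $A$ of type $FP_n$ and $Q$ of type $FP_{n+2}$, the fibre sum $\{(h_1,h_2)\in L_1\oplus L_2 \mid \pi_1(h_1)=\pi_2(h_2)\}$ is of type $FP_{n+1}$. For $m\ge 2$, the homological surjection conjecture over $K$ in degree $m$ is the following assertion. Let $k\ge m$, let $L_1,\dots,L_k$ be Lie algebras of type $FP_m$, and let $L\le L_1\oplus\cdots\oplus L_k$ be a Lie subalgebra that projects onto each $L_i$ (a subdirect sum), such that $L\cap L_i\ne 0$ for every $i$, and such that for all $1\le i_1<\cdots<i_m\le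 k$ the canonical projection of $L$ to $L_{i_1}\oplus\cdots\oplus L_{i_m}$ is surjective. Then $L$ is of type $FP_m$. **Theorem H.** Let $m\ge 2$. If the homological $n$-$(n+1)$-$(n+2)$ conjecture over $K$ holds for every $1\le n\le m-1$, then the homological surjection conjecture over $K$ holds in degree $m$. In particular, if the homological $(m-1)$-$m$-$(m+1)$ conjecture holds for all $m\ge 2$, then the homological surjection conjecture holds for all $m\ge 2$. -/

import Mathlib

open scoped DirectSum

universe u v

namespace LieFP

section TypeFP

variable (K : Type v) [Field K] (L : Type u) [LieRing L] [LieAlgebra K L]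

attribute [local instance 100] LieRing.ofAssociativeRing in
/-- The augmentation `𝒰(L) → K`: the algebra map that kills `L`. -/
noncomputable def augmentation : UniversalEnvelopingAlgebra K L →ₐ[K] K :=
  UniversalEnvelopingAlgebra.lift K (0 : L →ₗ⁅K⁆ K)

/-- The field `K` regarded as the trivial `𝒰(L)`-module, on which `L` acts as `0`. -/
@[nolint unusedArguments]
def TrivialModule (K : Type v) [Field K] (L : Type u) [LieRing L] [LieAlgebra K L] : Type v := K

instance : AddCommGroup (TrivialModule K L) := inferInstanceAs (AddCommGroup K)

noncomputable instance : Module (UniversalEnvelopingAlgebra K L) (TrivialModule K L) :=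
  Module.compHom K (augmentation K L).toRingHom

/-- The Lie algebra `L` over `K` is of type `FP_s`: the trivial `𝒰(L)`-module `K` has a
projective resolution `⋯ → P 1 → P 0 → K → 0` with `P i` finitely generated for `i ≤ s`. -/
def IsFP (s : ℕ) : Prop :=
  ∃ (P : ℕ → Type (max u v)) (_ : ∀ i, AddCommGroup (P i))
    (_ : ∀ i, Module (UniversalEnvelopingAlgebra K L) (P i))
    (d : ∀ i, P (i + 1) →ₗ[UniversalEnvelopingAlgebra K L] P i)
    (ε : P 0 →ₗ[UniversalEnvelopingAlgebra K L] TrivialModule K L),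
    (∀ i, Module.Projective (UniversalEnvelopingAlgebra K L) (P i)) ∧
    (∀ i, i ≤ s → Module.Finite (UniversalEnvelopingAlgebra K L) (P i)) ∧
    Function.Surjective ε ∧
    Function.Exact (d 0) ε ∧
    ∀ i, Function.Exact (d (i + 1)) (d i)

end TypeFP

section FibreSum

variable {K : Type v} [Field K] {L₁ L₂ Q : Type u}
  [LieRing L₁] [LieAlgebra K L₁] [LieRing L₂] [LieAlgebra K L₂] [LieRing Q] [LieAlgebra K Q]

/-- The fibre Lie sum `{(h₁, h₂) ∈ L₁ ⊕ L₂ | π₁ h₁ = π₂ h₂}`. -/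
def fibreSum (π₁ : L₁ →ₗ⁅K⁆ Q) (π₂ : L₂ →ₗ⁅K⁆ Q) : LieSubalgebra K (L₁ × L₂) where
  carrier := {h | π₁ h.1 = π₂ h.2}
  zero_mem' := by simp
  add_mem' := by
    intro a b ha hb
    simp only [Set.mem_ofPred_eq] at ha hb
    simp [ha, hb]
  smul_mem' := by
    intro c a ha
    simp only [Set.mem_ofPred_eq] at ha
    simp [ha]
  lie_mem' := by
    intro a b ha hb
    change π₁ a.1 = π₂ a.2 at ha
    change π₁ b.1 = π₂ b.2 at hb
    change π₁ ⁅a.1, b.1⁆ = π₂ ⁅a.2, b.2⁆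
    simp [ha, hb]

end FibreSum

/-- The homological `n`-`(n+1)`-`(n+2)` conjecture for Lie algebras over `K`, for one given `n`:
for short exact sequences `A ↣ L₁ ↠ Q` and `B ↣ L₂ ↠ Q` (here `A = ker π₁`, `B = ker π₂`) with
`L₁`, `L₂` of type `FP_{n+1}`, `A` of type `FP_n` and `Q` of type `FP_{n+2}`, the fibre Lie sum
is of type `FP_{n+1}`. -/
def HomologicalFibreConjecture (K : Type v) [Field K] (n : ℕ) : Prop :=
  ∀ (L₁ L₂ Q : Type u) [LieRing L₁] [LieAlgebra K L₁] [LieRing L₂] [LieAlgebra K L₂]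
    [LieRing Q] [LieAlgebra K Q] (π₁ : L₁ →ₗ⁅K⁆ Q) (π₂ : L₂ →ₗ⁅K⁆ Q),
    Function.Surjective π₁ → Function.Surjective π₂ →
    IsFP K L₁ (n + 1) → IsFP K L₂ (n + 1) → IsFP K π₁.ker n → IsFP K Q (n + 2) →
    IsFP K (fibreSum π₁ π₂) (n + 1)

section Subdirect

variable {K : Type v} [Field K] {k : ℕ} {M : Fin k → Type u}
  [∀ i, LieRing (M i)] [∀ i, LieAlgebra K (M i)]

/-- `L` is a subdirect Lie sum of the `M i`: it projects onto every single summand. -/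
def IsSubdirect (L : LieSubalgebra K (⨁ i, M i)) : Prop :=
  ∀ i, ∀ y : M i, ∃ x ∈ L, x i = y

/-- `L ∩ M i ≠ 0` for all `i`, where `M i` is embedded in the direct sum as the `i`-th summand. -/
def MeetsSummands (L : LieSubalgebra K (⨁ i, M i)) : Prop :=
  ∀ i, ∃ y : M i, y ≠ 0 ∧ DirectSum.of M i y ∈ L

/-- `L` projects onto the direct sum of any `m` of the summands. -/
def ProjectsOnto (L : LieSubalgebra K (⨁ i, M i)) (m : ℕ) : Prop :=
  ∀ S : Finset (Fin k), S.card = m → ∀ y : (∀ i : S, M i), ∃ x ∈ L, ∀ i : S, x i = y i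

end Subdirect

/-- The homological surjection conjecture for Lie algebras over `K`, for one given `m`. -/
def HomologicalSurjectionConjecture (K : Type v) [Field K] (m : ℕ) : Prop :=
  ∀ (k : ℕ), m ≤ k → ∀ (M : Fin k → Type u) [∀ i, LieRing (M i)] [∀ i, LieAlgebra K (M i)]
    (L : LieSubalgebra K (⨁ i, M i)),
    IsSubdirect L → MeetsSummands L → (∀ i, IsFP K (M i) m) → ProjectsOnto L m →
    IsFP K L m

end LieFP

-- The proof is a double induction, on `m` and on the number `k` of summands. As `m ≥ 2`, `L`
-- projects onto pairs of summands. For fixed `i`, take for each other summand an element of `L`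
-- with prescribed `i`-th coordinate that vanishes there: an iterated bracket of these has only its
-- `i`-th coordinate left. So `L` contains a term of the lower central series of every `M i`
-- (`exists_of_mem_lowerCentralSeries`). This property, with surjectivity onto few factors, is what
-- the induction carries (`IsHighlySubdirect`).
--
-- In the inductive step (`IsHighlySubdirect.isFP_succ`), `L` is the fibre sum of `M 0` and of its
-- projection `L ⧸ I` to the other factors, over `Q = M 0 ⧸ (L ∩ M 0)`. Here `L ⧸ I` has one factor
-- fewer. The kernel of `L ⧸ I → Q` consists of the projections of elements with zero coordinate in
-- `M 0`; it maps onto any `m` of the other factors if `L` maps onto any `m + 1`, so it falls under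
-- the induction on `m`. Finally `Q` is finitely generated and nilpotent, hence of type `FP_s` for
-- all `s`, and the fibre conjecture applies.
--
-- Two facts support this. A finitely generated nilpotent Lie algebra is finite-dimensional and its
-- enveloping algebra is noetherian by a Hilbert basis argument
-- (`isNoetherianRing_universalEnvelopingAlgebra`). And `FP_1` means finitely generated, which
-- starts the induction at `m = 1` through `isFG_of_subdirect`. The hard direction, `IsFP.isFG`,
-- needs the consequence `mem_of_ι_mem_span` of the Poincaré–Birkhoff–Witt theorem, obtained by
-- straightening words.

universe w

namespace LieFP

/-! ### Inversions and descents of words. -/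

section Words

variable {ι : Type*} [LinearOrder ι]

/-- The number of inversions of a word. -/
def inversions : List ι → ℕ
  | [] => 0
  | x :: l => l.countP (· < x) + inversions l

theorem inversions_swap (a c : List ι) {x y : ι} (h : y < x) :
    inversions (a ++ y :: x :: c) < inversions (a ++ x :: y :: c) := by
  induction a with
  | nil =>
    simp only [List.nil_append, inversions, List.countP_cons]
    simp [h, h.not_gt]
    omega
  | cons z a ih =>
    have : (a ++ y :: x :: c).countP (· < z) = (a ++ x :: y :: c).countP (· < z) :=
      (List.Perm.append_left a (List.Perm.swap x y c)).countP_eq _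
    simp only [List.cons_append, inversions, this]
    omega

/-- `IsDescent w d` says that `d = (a, x, y, c)` exhibits a descent `y < x` of `w = a x y c`. -/
def IsDescent (w : List ι) (d : List ι × ι × ι × List ι) : Prop :=
  w = d.1 ++ d.2.1 :: d.2.2.1 :: d.2.2.2 ∧ d.2.2.1 < d.2.1

theorem IsDescent.inversions_lt {w : List ι} {d : List ι × ι × ι × List ι} (h : IsDescent w d) :
    inversions (d.1 ++ d.2.2.1 :: d.2.1 :: d.2.2.2) < inversions w := by
  rw [h.1]
  exact inversions_swap _ _ h.2

end Words

/-! ### Straightening words in a basis, in the manner of the diamond lemma. -/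

section Straightening

variable {K L ι : Type*} [Field K] [LieRing L] [LieAlgebra K L]
variable (b : Module.Basis ι K L)

/-- The linear extension in one letter of a function on words in a basis. -/
noncomputable def letterExt (f : List ι → K) (a c : List ι) : L →ₗ[K] K :=
  b.constr K fun z => f (a ++ z :: c)

@[simp]
theorem letterExt_basis (f : List ι → K) (a c : List ι) (z : ι) :
    letterExt b f a c (b z) = f (a ++ z :: c) := by
  simp [letterExt]

/-- The bilinear extension in two letters of a function on words in a basis. -/
noncomputable def letterExt₂ (f : List ι → K) (a m c : List ι) : L →ₗ[K] L →ₗ[K] K :=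
  b.constr K fun s => letterExt b f (a ++ s :: m) c

theorem letterExt₂_basis_left (f : List ι → K) (a m c : List ι) (z : ι) (q : L) :
    letterExt₂ b f a m c (b z) q = letterExt b f (a ++ z :: m) c q := by
  simp [letterExt₂]

theorem letterExt₂_basis_right (f : List ι → K) (a m c : List ι) (z : ι) (p : L) :
    letterExt₂ b f a m c p (b z) = letterExt b f a (m ++ z :: c) p := by
  have : (letterExt₂ b f a m c).flip (b z) = letterExt b f a (m ++ z :: c) := by
    apply b.ext
    intro s
    simp [letterExt₂]
  exact LinearMap.congr_fun this p

theorem letterExt_congr {f g : List ι → K} {a c : List ι}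
    (h : ∀ z, f (a ++ z :: c) = g (a ++ z :: c)) : letterExt b f a c = letterExt b g a c := by
  simp only [letterExt, h]

/-- A function on words in a basis is a Lie functional if exchanging two adjacent letters changes
it by its value at the word in which they are replaced by their bracket. -/
def IsLieFunctional (f : List ι → K) : Prop :=
  ∀ a x y c, f (a ++ x :: y :: c) - f (a ++ y :: x :: c) = letterExt b f a c ⁅b x, b y⁆

variable [LinearOrder ι]

/-- This is the confluence step of the diamond lemma. Two descents of one word coincide, overlap in
a letter, or are disjoint. In the last two cases both reductions continue to a common word, and the
correction terms agree by the rule for shorter words, together with the Jacobi identity in the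
overlapping case. -/
theorem descents_agree_of_lt {f : List ι → K} {n j : ℕ}
    (hn : ∀ a x y c, a.length + c.length + 2 < n →
      f (a ++ x :: y :: c) - f (a ++ y :: x :: c) = letterExt b f a c ⁅b x, b y⁆)
    (hj : ∀ a x y c, a.length + c.length + 2 = n → inversions (a ++ x :: y :: c) < j → y < x →
      f (a ++ x :: y :: c) = f (a ++ y :: x :: c) + letterExt b f a c ⁅b x, b y⁆)
    {a c t c' : List ι} {x y x' y' : ι} (hlen : a.length + c.length + 2 = n)
    (hinv : inversions (a ++ x :: y :: c) = j) (h : y < x) (h' : y' < x')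
    (heq : x :: y :: c = t ++ x' :: y' :: c') :
    f (a ++ y :: x :: c) + letterExt b f a c ⁅b x, b y⁆ =
      f (a ++ t ++ y' :: x' :: c') + letterExt b f (a ++ t) c' ⁅b x', b y'⁆ := by
  match t, heq with
  | [], heq =>
    simp only [List.nil_append, List.cons.injEq] at heq
    obtain ⟨rfl, rfl, rfl⟩ := heq
    simp
  -- Overlap `x > y > y'`: both routes end at `y' y x`, through `y x y'` or through `x y' y`. The
  -- rule for shorter words turns the difference of the corrections into a Jacobi sum.
  | [_], heq =>
    simp only [List.cons_append, List.nil_append, List.cons.injEq] at heq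
    obtain ⟨rfl, rfl, rfl⟩ := heq
    simp only [List.length_cons] at hlen
    have i₁ := inversions_swap a (y' :: c') h
    have i₂ := inversions_swap (a ++ [x]) c' h'
    have i₃ := inversions_swap (a ++ [y]) c' (h'.trans h)
    have i₄ := inversions_swap a (y :: c') (h'.trans h)
    simp only [List.append_assoc, List.cons_append, List.nil_append] at i₁ i₂ i₃ i₄ ⊢
    have e₁ := hj (a ++ [y]) x y' c' (by simp; omega) (by simp; omega) (h'.trans h)
    have e₂ := hj a y y' (x :: c') (by simp; omega) (by omega) h'
    have e₃ := hj a x y' (y :: c') (by simp; omega) (by omega) (h'.trans h)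
    have e₄ := hj (a ++ [y']) x y c' (by simp; omega) (by simp; omega) h
    simp only [List.append_assoc, List.cons_append, List.nil_append] at e₁ e₂ e₃ e₄
    rw [e₁, e₂, e₃, e₄]
    have hb : ∀ p q, letterExt₂ b f a [] c' p q - letterExt₂ b f a [] c' q p =
        letterExt b f a c' ⁅p, q⁆ := by
      have : letterExt₂ b f a [] c' - (letterExt₂ b f a [] c').flip =
          (LieModule.toEnd K L L : L →ₗ[K] Module.End K L).compr₂ (letterExt b f a c') := by
        refine b.ext fun s => b.ext fun t => ?_
        have := hn a s t c' (by omega)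
        simpa [letterExt₂] using this
      intro p q
      simpa using LinearMap.congr_fun (LinearMap.congr_fun this p) q
    have j₁ := hb ⁅b x, b y⁆ (b y')
    have j₂ := hb ⁅b y, b y'⁆ (b x)
    have j₃ := hb (b y) ⁅b x, b y'⁆
    simp only [letterExt₂_basis_left, letterExt₂_basis_right, List.nil_append] at j₁ j₂ j₃
    have jac : ⁅⁅b x, b y⁆, b y'⁆ + ⁅⁅b y, b y'⁆, b x⁆ + ⁅b y, ⁅b x, b y'⁆⁆ = 0 := by
      have := lie_jacobi (b x) (b y) (b y')
      rw [← lie_skew (b x) (b y'), lie_neg, ← lie_skew ⁅b x, b y⁆ (b y'),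
        ← lie_skew ⁅b y, b y'⁆ (b x), ← neg_eq_zero, ← this]
      abel
    have jac' := congrArg (letterExt b f a c') jac
    simp only [map_add, map_zero] at jac'
    linear_combination j₁ + j₂ + j₃ + jac'
  -- Disjoint descents: each exchange can follow the other, and both mixed corrections involve the
  -- same value of `letterExt₂` at the two brackets.
  | _ :: _ :: m, heq =>
    simp only [List.cons_append, List.cons.injEq] at heq
    obtain ⟨rfl, rfl, rfl⟩ := heq
    simp only [List.length_append, List.length_cons] at hlen
    have i₁ := inversions_swap a (m ++ x' :: y' :: c') h
    have i₂ := inversions_swap (a ++ x :: y :: m) c' h'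
    simp only [List.append_assoc, List.cons_append] at i₁ i₂ ⊢
    have e₁ := hj (a ++ y :: x :: m) x' y' c' (by simp; omega) (by simp; omega) h'
    have e₂ := hj a x y (m ++ y' :: x' :: c') (by simp; omega) (by omega) h
    simp only [List.append_assoc, List.cons_append] at e₁ e₂
    rw [e₁, e₂]
    have h₁ : ∀ p, letterExt b f a (m ++ x' :: y' :: c') p - letterExt b f a (m ++ y' :: x' :: c') p =
        letterExt₂ b f a m c' p ⁅b x', b y'⁆ := by
      have : letterExt b f a (m ++ x' :: y' :: c') - letterExt b f a (m ++ y' :: x' :: c') =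
          (letterExt₂ b f a m c').flip ⁅b x', b y'⁆ := by
        refine b.ext fun s => ?_
        have := hn (a ++ s :: m) x' y' c' (by simp; omega)
        simpa [letterExt₂] using this
      intro p
      simpa using LinearMap.congr_fun this p
    have h₂ : ∀ q, letterExt b f (a ++ x :: y :: m) c' q - letterExt b f (a ++ y :: x :: m) c' q =
        letterExt₂ b f a m c' ⁅b x, b y⁆ q := by
      have : letterExt b f (a ++ x :: y :: m) c' - letterExt b f (a ++ y :: x :: m) c' =
          letterExt₂ b f a m c' ⁅b x, b y⁆ := by
        refine b.ext fun s => ?_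
        have := hn a x y (m ++ s :: c') (by simp; omega)
        simpa [letterExt₂_basis_right] using this
      intro q
      simpa using LinearMap.congr_fun this q
    linear_combination h₁ ⁅b x, b y⁆ - h₂ ⁅b x', b y'⁆

/-- If a function on words satisfies the exchange rule at one descent of every word that has a
descent, then it satisfies the rule everywhere. -/
theorem isLieFunctional_of_exists_descent {f : List ι → K}
    (hf : ∀ w d₀, IsDescent w d₀ → ∃ d, IsDescent w d ∧
      f w = f (d.1 ++ d.2.2.1 :: d.2.1 :: d.2.2.2) +
        letterExt b f d.1 d.2.2.2 ⁅b d.2.1, b d.2.2.1⁆) : IsLieFunctional b f := by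
  -- Outer induction on the length, since brackets shorten words; inner induction on inversions,
  -- since exchanges at descents lower them.
  have key : ∀ n, ∀ a x y c, a.length + c.length + 2 = n →
      f (a ++ x :: y :: c) - f (a ++ y :: x :: c) = letterExt b f a c ⁅b x, b y⁆ := by
    intro n
    induction n using Nat.strong_induction_on with
    | _ n hn =>
    have hlt : ∀ j, ∀ a x y c, a.length + c.length + 2 = n → inversions (a ++ x :: y :: c) = j →
        y < x → f (a ++ x :: y :: c) = f (a ++ y :: x :: c) + letterExt b f a c ⁅b x, b y⁆ := by
      intro j
      induction j using Nat.strong_induction_on with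
      | _ j hj =>
      intro a x y c hlen hinv h
      have hn' : ∀ a x y c, a.length + c.length + 2 < n →
        f (a ++ x :: y :: c) - f (a ++ y :: x :: c) = letterExt b f a c ⁅b x, b y⁆ :=
        fun a x y c hl => hn _ hl a x y c rfl
      have hj' : ∀ a x y c, a.length + c.length + 2 = n → inversions (a ++ x :: y :: c) < j →
        y < x → f (a ++ x :: y :: c) = f (a ++ y :: x :: c) + letterExt b f a c ⁅b x, b y⁆ :=
        fun a x y c hl hi => hj _ hi a x y c hl rfl
      obtain ⟨⟨a', x', y', c'⟩, ⟨hw, h'⟩, hfw⟩ := hf _ (a, x, y, c) ⟨rfl, h⟩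
      simp only at hw h' hfw
      rw [hfw]
      rcases List.append_eq_append_iff.1 hw with ⟨t, rfl, ht⟩ | ⟨t, rfl, ht⟩
      · exact (descents_agree_of_lt b hn' hj' hlen hinv h h' ht).symm
      · refine descents_agree_of_lt b hn' hj' ?_ ?_ h' h ht
        · have := congrArg List.length hw
          simp at this hlen
          omega
        · rw [← hw, hinv]
    intro a x y c hlen
    rcases lt_trichotomy x y with h | rfl | h
    · rw [hlt _ a y x c hlen rfl h, ← lie_skew (b x), map_neg]
      ring
    · simp
    · rw [hlt _ a x y c hlen rfl h]
      ring
  exact fun a x y c => key _ a x y c rfl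

open Classical in
/-- Extends a function on words of length `n` to words of length `n + 1` by straightening, with
value zero at the straight words. -/
noncomputable def straightenStep (g : List ι → K) (w : List ι) : K :=
  if h : ∃ d, IsDescent w d then
    straightenStep g (h.choose.1 ++ h.choose.2.2.1 :: h.choose.2.1 :: h.choose.2.2.2) +
      letterExt b g h.choose.1 h.choose.2.2.2 ⁅b h.choose.2.1, b h.choose.2.2.1⁆
  else 0
termination_by inversions w
decreasing_by exact h.choose_spec.inversions_lt

/-- Iterated straightening, with prescribed values `l` at the words of length one. -/
noncomputable def straightenLevel (l : ι → K) : ℕ → List ι → K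
  | 0 => fun _ => 0
  -- Level `n` is only evaluated at words of length `n`, so this sum has a single term.
  | 1 => fun w => (w.map l).sum
  | n + 2 => straightenStep b (straightenLevel l (n + 1))

/-- The function on words that vanishes at the straight words of length other than one, takes the
values `l` at the letters, and is a Lie functional. -/
noncomputable def straighten (l : ι → K) (w : List ι) : K :=
  straightenLevel b l w.length w

theorem straighten_singleton (l : ι → K) (z : ι) : straighten b l [z] = l z := by
  simp [straighten, straightenLevel]

theorem straighten_eq_zero (l : ι → K) {w : List ι} (hw : w.length ≠ 1)
    (h : ¬ ∃ d, IsDescent w d) : straighten b l w = 0 := by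
  unfold straighten
  match hn : w.length, hw with
  | 0, _ => rfl
  | n + 2, _ =>
    rw [straightenLevel, straightenStep, dif_neg h]

theorem isLieFunctional_straighten (l : ι → K) : IsLieFunctional b (straighten b l) := by
  refine isLieFunctional_of_exists_descent b fun w d₀ hd₀ => ?_
  have h : ∃ d, IsDescent w d := ⟨d₀, hd₀⟩
  refine ⟨h.choose, h.choose_spec, ?_⟩
  generalize hd : h.choose = d
  have hs : IsDescent w d := hd ▸ h.choose_spec
  obtain ⟨n, hn⟩ : ∃ n, w.length = n + 2 := ⟨d.1.length + d.2.2.2.length, by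
    rw [hs.1]; simp; omega⟩
  have hl := congrArg List.length hs.1
  simp only [List.length_append, List.length_cons] at hl
  unfold straighten
  rw [hn, straightenLevel, straightenStep, dif_pos h, hd]
  congr 1
  · have : (d.1 ++ d.2.2.1 :: d.2.1 :: d.2.2.2).length = n + 2 := by simp; omega
    rw [this, straightenLevel]
  · refine LinearMap.congr_fun (letterExt_congr b fun z => ?_) _
    have : (d.1 ++ z :: d.2.2.2).length = n + 1 := by simp; omega
    rw [this]

/-- If an upper set of basis vectors spans a subalgebra `H` on which `l` vanishes, straightening
gives zero at every word that ends in `H`. -/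
theorem straighten_append_eq_zero (l : ι → K) (H : LieSubalgebra K L) {p : ι → Prop}
    (hp : ∀ i j, i ≤ j → p i → p j) (hH : H.toSubmodule = Submodule.span K (b '' {i | p i}))
    (hl : ∀ i, p i → l i = 0) (w : List ι) {z : ι} (hz : p z) :
    straighten b l (w ++ [z]) = 0 := by
  have hmem : ∀ i, p i → b i ∈ H := fun i hi => by
    rw [← LieSubalgebra.mem_toSubmodule, hH]
    exact Submodule.subset_span ⟨i, hi, rfl⟩
  have hL := isLieFunctional_straighten b l
  have key : ∀ n j, ∀ w z, w.length = n → inversions (w ++ [z]) = j → p z →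
      straighten b l (w ++ [z]) = 0 := by
    intro n
    induction n using Nat.strong_induction_on with
    | _ n hn =>
    intro j
    induction j using Nat.strong_induction_on with
    | _ j hj =>
    intro w z hw hj' hz
    by_cases hd : ∃ d, IsDescent (w ++ [z]) d
    · obtain ⟨⟨a, x, y, c⟩, h, hyx⟩ := hd
      simp only at h hyx
      have hrel := hL a x y c
      -- If the descent involves the last letter `z`, then `x > z` also satisfies `p`, so the
      -- exchanged word still ends in `H` and `⁅b x, b z⁆` lies in `H`. Otherwise the last letter
      -- survives both the exchange and the bracket.
      rcases List.eq_nil_or_concat c with rfl | ⟨c, t, rfl⟩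
      · have h' : w ++ [z] = (a ++ [x]) ++ [y] := by simpa using h
        obtain ⟨rfl, hzy⟩ := List.append_inj' h' rfl
        obtain rfl : z = y := by simpa using hzy
        have hx : p x := hp _ _ hyx.le hz
        have h₁ := hj _ (by rw [← hj', h]; exact inversions_swap a [] hyx) (a ++ [z]) x
          (by simpa using hw) (by simp) hx
        have h₂ : letterExt b (straighten b l) a [] ⁅b x, b z⁆ = 0 := by
          have : ⁅b x, b z⁆ ∈ Submodule.span K (b '' {i | p i}) := by
            rw [← hH]
            exact H.lie_mem (hmem _ hx) (hmem _ hz)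
          refine (Submodule.span_le (p := LinearMap.ker _)).2 ?_ this
          rintro _ ⟨i, hi, rfl⟩
          simpa using hn a.length (by simp at hw; omega) _ a i rfl rfl hi
        rw [h₂] at hrel
        rw [h]
        simpa [show straighten b l (a ++ [z, x]) = 0 by simpa using h₁] using hrel
      · rw [List.concat_eq_append] at *
        have h' : w ++ [z] = (a ++ x :: y :: c) ++ [t] := by simpa using h
        obtain ⟨rfl, hzy⟩ := List.append_inj' h' rfl
        obtain rfl : z = t := by simpa using hzy
        have h₁ := hj _ (by rw [← hj', h]; exact inversions_swap a _ hyx) (a ++ y :: x :: c) z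
          (by simpa using hw) (by simp) hz
        have h₂ : letterExt b (straighten b l) a (c ++ [z]) = 0 := by
          refine b.ext fun i => ?_
          simpa using hn (a.length + c.length + 1) (by simp at hw; omega) _ (a ++ i :: c) z
            (by simp; omega) rfl hz
        rw [h₂, show straighten b l (a ++ y :: x :: (c ++ [z])) = 0 by simpa using h₁] at hrel
        rw [h]
        simpa using hrel
    · by_cases hw0 : w = []
      · subst hw0
        simpa [straighten_singleton] using hl z hz
      · refine straighten_eq_zero b l ?_ hd
        simpa using hw0
  exact key _ _ w z rfl rfl hz

end Straightening

/-! ### The Lie functionals as a representation of the Lie algebra. -/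

section LieFunctionals

variable {K L ι : Type*} [Field K] [LieRing L] [LieAlgebra K L]
variable (b : Module.Basis ι K L)

theorem letterExt_add (f g : List ι → K) (a c : List ι) :
    letterExt b (f + g) a c = letterExt b f a c + letterExt b g a c :=
  b.ext fun i => by simp

theorem letterExt_smul (r : K) (f : List ι → K) (a c : List ι) :
    letterExt b (r • f) a c = r • letterExt b f a c :=
  b.ext fun i => by simp

/-- The space of Lie functionals. -/
def lieFunctionals : Submodule K (List ι → K) where
  carrier := {f | IsLieFunctional b f}
  zero_mem' a x y c := by
    rw [show letterExt b (0 : List ι → K) a c = 0 from b.ext fun i => by simp]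
    simp
  add_mem' {f g} hf hg a x y c := by
    have h₁ := hf a x y c
    have h₂ := hg a x y c
    simp only [letterExt_add, Pi.add_apply, LinearMap.add_apply]
    linear_combination h₁ + h₂
  smul_mem' r f hf a x y c := by
    have h₁ := hf a x y c
    simp only [letterExt_smul, Pi.smul_apply, LinearMap.smul_apply, smul_eq_mul]
    linear_combination r * h₁

/-- The action of an element of `L` on functions on words, by inserting it at the end. -/
noncomputable def rightInsert : L →ₗ[K] (List ι → K) →ₗ[K] (List ι → K) :=
  LinearMap.mk₂ K (fun x f w => letterExt b f w [] x) (by intros; ext; simp)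
    (by intros; ext; simp) (by intros; ext; simp [letterExt_add])
    (by intros; ext; simp [letterExt_smul])

theorem rightInsert_apply (x : L) (f : List ι → K) (w : List ι) :
    rightInsert b x f w = letterExt b f w [] x := rfl

theorem rightInsert_mem (x : L) {f : List ι → K} (hf : f ∈ lieFunctionals b) :
    rightInsert b x f ∈ lieFunctionals b := by
  have : (⊤ : Submodule K L) ≤ (lieFunctionals b).comap ((rightInsert b).flip f) := by
    rw [← b.span_eq, Submodule.span_le]
    rintro _ ⟨i, rfl⟩ a y z c
    have h := hf a y z (c ++ [i])
    have e : letterExt b (rightInsert b (b i) f) a c = letterExt b f a (c ++ [i]) :=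
      b.ext fun j => by simp [rightInsert_apply]
    simp only [LinearMap.flip_apply]
    rw [e, ← h]
    simp [rightInsert_apply]
  exact this (Submodule.mem_top (x := x))

/-- This is the exchange rule at the end of a word, extended bilinearly from basis vectors to `L`.
It makes the Lie functionals a module that plays the role of the dual of `𝒰(L)`, with `u` sending
`f` to `v ↦ f (v * u)`. -/
theorem rightInsert_lie (x y : L) {f : List ι → K} (hf : f ∈ lieFunctionals b) :
    rightInsert b ⁅x, y⁆ f = rightInsert b x (rightInsert b y f) -
      rightInsert b y (rightInsert b x f) := by
  ext w
  have hb : letterExt₂ b f w [] [] - (letterExt₂ b f w [] []).flip =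
      (LieModule.toEnd K L L : L →ₗ[K] Module.End K L).compr₂ (letterExt b f w []) := by
    refine b.ext fun s => b.ext fun t => ?_
    simpa [letterExt₂] using hf w s t []
  have he : ∀ x y, letterExt b (rightInsert b y f) w [] x = letterExt₂ b f w [] [] x y := by
    intro x y
    have : letterExt b (rightInsert b y f) w [] = (letterExt₂ b f w [] []).flip y := by
      refine b.ext fun i => ?_
      simp [rightInsert_apply, letterExt₂]
    rw [this, LinearMap.flip_apply]
  have := LinearMap.congr_fun (LinearMap.congr_fun hb x) y
  simp only [rightInsert_apply, Pi.sub_apply, he]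
  simpa using this.symm

attribute [local instance 100] LieRing.ofAssociativeRing in
/-- The representation of `L` on the space of Lie functionals. -/
noncomputable def lieFunctionalsRep : L →ₗ⁅K⁆ Module.End K (lieFunctionals b) where
  toFun x := (rightInsert b x).restrict fun _ hf => rightInsert_mem b x hf
  map_add' x y := by ext; simp
  map_smul' r x := by ext; simp
  map_lie' {x y} := by
    ext f : 2
    simpa [LieRing.of_associative_ring_bracket] using rightInsert_lie b x y f.2

end LieFunctionals

/-! ### Recovering a subalgebra from the left ideal that it generates. -/

/-- A proper subalgebra `H` of `L` generates a left ideal of `𝒰(L)` that contains no element of `L`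
outside `H`. -/
theorem mem_of_ι_mem_span {K : Type*} {L : Type*} [Field K] [LieRing L] [LieAlgebra K L]
    (H : LieSubalgebra K L) {x : L}
    (hx : UniversalEnvelopingAlgebra.ι K x ∈ Submodule.span (UniversalEnvelopingAlgebra K L)
      (UniversalEnvelopingAlgebra.ι K '' (H : Set L))) : x ∈ H := by
  by_contra hxH
  obtain ⟨C, hC⟩ := Submodule.exists_isCompl H.toSubmodule
  let bC := Module.Basis.ofVectorSpace K C
  let bH := Module.Basis.ofVectorSpace K H.toSubmodule
  let : LinearOrder (Module.Basis.ofVectorSpaceIndex K C) :=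
    IsWellOrder.linearOrder WellOrderingRel
  let : LinearOrder (Module.Basis.ofVectorSpaceIndex K H.toSubmodule) :=
    IsWellOrder.linearOrder WellOrderingRel
  -- In the lexicographic order the basis vectors of `H` come after those of the complement, so they
  -- form an upper set.
  let b := ((bC.prod bH).map (Submodule.prodEquivOfIsCompl C _ hC.symm)).reindex toLex
  obtain ⟨l, hlx, hlH⟩ := Submodule.exists_le_ker_of_notMem (p := H.toSubmodule) hxH
  let p : (Module.Basis.ofVectorSpaceIndex K C) ⊕ₗ
    (Module.Basis.ofVectorSpaceIndex K H.toSubmodule) → Prop := fun i => (ofLex i).isRight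
  have hbr : ∀ i, b (toLex (Sum.inr i)) = (bH i : L) := fun i => by simp [b]
  have hbp : ∀ i, p i → b i ∈ H := by
    intro i hi
    match i, hi with
    | Sum.inr i, _ => exact hbr i ▸ (bH i).2
  have hH : H.toSubmodule = Submodule.span K (b '' {i | p i}) := by
    apply le_antisymm
    · have : H.toSubmodule = (Submodule.span K (Set.range bH)).map H.toSubmodule.subtype := by
        rw [bH.span_eq, Submodule.map_subtype_top]
      refine this.le.trans ?_
      rw [Submodule.map_span]
      apply Submodule.span_mono
      rintro _ ⟨_, ⟨i, rfl⟩, rfl⟩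
      exact ⟨toLex (Sum.inr i), by simp [p], hbr i⟩
    · rw [Submodule.span_le]
      rintro _ ⟨i, hi, rfl⟩
      exact hbp i hi
  have hp : ∀ i j, i ≤ j → p i → p j := by
    intro i j hij hi
    match i, j, hij, hi with
    | Sum.inr i, Sum.inr j, _, _ => rfl
    | Sum.inr i, Sum.inl j, hij, _ => exact absurd hij (Sum.Lex.not_inr_le_inl)
  have hz := fun w z => straighten_append_eq_zero b (fun i => l (b i)) H hp hH
    (fun i hi => hlH (hbp i hi)) w (z := z)
  let F : lieFunctionals b := ⟨_, isLieFunctional_straighten b fun i => l (b i)⟩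
  let ρ := UniversalEnvelopingAlgebra.lift K (lieFunctionalsRep b)
  have hρ : ∀ y, ρ (UniversalEnvelopingAlgebra.ι K y) = lieFunctionalsRep b y :=
    UniversalEnvelopingAlgebra.lift_ι_apply K _
  -- `F` vanishes at words ending in `H`, so `H` annihilates it; the annihilator of `F` is a left
  -- ideal.
  have hF : ∀ u ∈ Submodule.span (UniversalEnvelopingAlgebra K L)
      (UniversalEnvelopingAlgebra.ι K '' (H : Set L)), ρ u F = 0 := by
    intro u hu
    induction hu using Submodule.span_induction with
    | zero => simp
    | add u v _ _ hu hv => simp [hu, hv]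
    | smul r u _ hu => simp [hu]
    | mem u hu =>
      obtain ⟨y, hy, rfl⟩ := hu
      rw [hρ]
      ext w
      have hle : H.toSubmodule ≤ LinearMap.ker (letterExt b F.1 w []) := by
        refine hH.le.trans (Submodule.span_le.2 ?_)
        rintro _ ⟨i, hi, rfl⟩
        simpa using hz w i hi
      exact hle hy
  -- At the empty word, `x` acting on `F` has the value `l x`, which is nonzero.
  have h0 := congrArg (fun f : lieFunctionals b => f.1 []) ((hρ x) ▸ hF _ hx)
  have h1 : letterExt b F.1 [] [] = l := b.ext fun i => by simp [F, straighten_singleton]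
  have h2 : letterExt b F.1 [] [] x = 0 := h0
  rw [h1] at h2
  exact hlx h2

/-! ### Projective resolutions from iterated syzygies. -/

section Resolution

variable {R : Type w} [Ring R]

theorem exists_free_cover (N : ModuleCat.{w} R) :
    ∃ (F : ModuleCat.{w} R) (f : F →ₗ[R] N), Module.Projective R F ∧
      (Module.Finite R N → Module.Finite R F) ∧ Function.Surjective f := by
  by_cases h : Module.Finite R N
  · obtain ⟨n, f, hf⟩ := Module.Finite.exists_fin' R N
    exact ⟨ModuleCat.of R (Fin n → R), f, inferInstanceAs (Module.Projective R (Fin n → R)),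
      fun _ => inferInstanceAs (Module.Finite R (Fin n → R)), hf⟩
  · exact ⟨ModuleCat.of R (N →₀ R), Finsupp.linearCombination R id,
      inferInstanceAs (Module.Projective R (N →₀ R)), fun h' => absurd h' h,
      Finsupp.linearCombination_id_surjective R N⟩

/-- A projective cover of a module, finitely generated if the module is. -/
noncomputable def freeCover (N : ModuleCat.{w} R) : ModuleCat.{w} R :=
  (exists_free_cover N).choose

/-- The projection from the cover. -/
noncomputable def freeCoverMap (N : ModuleCat.{w} R) : freeCover N →ₗ[R] N :=
  (exists_free_cover N).choose_spec.choose

theorem freeCover_spec (N : ModuleCat.{w} R) : Module.Projective R (freeCover N) ∧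
    (Module.Finite R N → Module.Finite R (freeCover N)) ∧
    Function.Surjective (freeCoverMap N) :=
  (exists_free_cover N).choose_spec.choose_spec

/-- The iterated syzygies of a module. -/
noncomputable def syzygy (N : ModuleCat.{w} R) : ℕ → ModuleCat.{w} R
  | 0 => N
  | i + 1 => ModuleCat.of R (LinearMap.ker (freeCoverMap (syzygy N i)))

/-- The inclusion of a syzygy into the cover of the preceding one. -/
noncomputable def syzygyIncl (N : ModuleCat.{w} R) (i : ℕ) :
    syzygy N (i + 1) →ₗ[R] freeCover (syzygy N i) :=
  (LinearMap.ker (freeCoverMap (syzygy N i))).subtype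

theorem syzygyIncl_injective (N : ModuleCat.{w} R) (i : ℕ) :
    Function.Injective (syzygyIncl N i) := Subtype.val_injective

theorem exact_syzygyIncl (N : ModuleCat.{w} R) (i : ℕ) :
    Function.Exact (syzygyIncl N i) (freeCoverMap (syzygy N i)) := fun x =>
  ⟨fun h => ⟨⟨x, h⟩, rfl⟩, by rintro ⟨y, rfl⟩; exact y.2⟩

/-- The terms of a resolution that starts with `R`. -/
noncomputable def resolutionTerm (I : ModuleCat.{w} R) : ℕ → ModuleCat.{w} R
  | 0 => ModuleCat.of R R
  | i + 1 => freeCover (syzygy I i)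

/-- The differentials of a resolution that starts with `R`. -/
noncomputable def resolutionMap (I : ModuleCat.{w} R) (j : I →ₗ[R] R) :
    ∀ i, resolutionTerm I (i + 1) →ₗ[R] resolutionTerm I i
  | 0 => j.comp (freeCoverMap I)
  | i + 1 => (syzygyIncl I i).comp (freeCoverMap (syzygy I (i + 1)))

theorem exact_comp_surjective {A B C D : Type*} [Zero D] {f : B → C} {p : A → B} {g : C → D}
    (hp : Function.Surjective p) (h : Function.Exact f g) : Function.Exact (f ∘ p) g := by
  intro x
  rw [h x, hp.range_comp]

theorem exact_injective_comp {A B C D : Type*} [Zero C] [Zero D] {f : A → B} {g : B → C} {j : C → D}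
    (hj : Function.Injective j) (hj0 : j 0 = 0) (h : Function.Exact f g) :
    Function.Exact f (j ∘ g) := by
  intro x
  rw [← h x, Function.comp_apply, ← hj0, hj.eq_iff]

/-- Splice covers of the successive syzygies of `ker ε`, starting with `R` itself. The term in
degree `i + 1` covers the `i`-th syzygy, so only syzygies of index below `s` must be finitely
generated. -/
theorem exists_resolution {T : Type*} [AddCommGroup T] [Module R T] (ε : R →ₗ[R] T)
    (hε : Function.Surjective ε) (s : ℕ)
    (hs : ∀ i, i < s → Module.Finite R (syzygy (ModuleCat.of R (LinearMap.ker ε)) i)) :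
    ∃ (P : ℕ → Type w) (_ : ∀ i, AddCommGroup (P i)) (_ : ∀ i, Module R (P i))
      (d : ∀ i, P (i + 1) →ₗ[R] P i) (ε : P 0 →ₗ[R] T),
      (∀ i, Module.Projective R (P i)) ∧ (∀ i, i ≤ s → Module.Finite R (P i)) ∧
      Function.Surjective ε ∧ Function.Exact (d 0) ε ∧
      ∀ i, Function.Exact (d (i + 1)) (d i) := by
  let I := ModuleCat.of R (LinearMap.ker ε)
  let j : I →ₗ[R] R := (LinearMap.ker ε).subtype
  refine ⟨fun i => resolutionTerm I i, fun i => inferInstance, fun i => inferInstance,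
    resolutionMap I j, ε, ?_, ?_, hε, ?_, ?_⟩
  · rintro (_ | i)
    · exact inferInstanceAs (Module.Projective R R)
    · exact (freeCover_spec _).1
  · rintro (_ | i) hi
    · exact inferInstanceAs (Module.Finite R R)
    · exact (freeCover_spec _).2.1 (hs i hi)
  · refine exact_comp_surjective (freeCover_spec I).2.2 (f := j) (g := ε) fun x => ?_
    exact ⟨fun h => ⟨⟨x, h⟩, rfl⟩, by rintro ⟨y, rfl⟩; exact y.2⟩
  · rintro (_ | i)
    · exact exact_injective_comp (f := resolutionMap I j 1) (g := freeCoverMap I) (j := j)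
        Subtype.val_injective rfl
        (exact_comp_surjective (p := freeCoverMap (syzygy I 1)) (freeCover_spec _).2.2
          (exact_syzygyIncl I 0))
    · exact exact_injective_comp (f := resolutionMap I j (i + 2))
        (g := freeCoverMap (syzygy I (i + 1))) (j := syzygyIncl I i)
        (syzygyIncl_injective I i) (map_zero _)
        (exact_comp_surjective (p := freeCoverMap (syzygy I (i + 2))) (freeCover_spec _).2.2
          (exact_syzygyIncl I (i + 1)))

theorem finite_syzygy [IsNoetherianRing R] (N : ModuleCat.{w} R) (hN : Module.Finite R N) (i : ℕ) :
    Module.Finite R (syzygy N i) := by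
  induction i with
  | zero => exact hN
  | succ i ih =>
    have := (freeCover_spec (syzygy N i)).2.1 ih
    exact inferInstanceAs (Module.Finite R (LinearMap.ker (freeCoverMap (syzygy N i))))

end Resolution

/-! ### The augmentation ideal, and `FP_1` as finite generation. -/

section Augmentation

attribute [local instance 100] LieRing.ofAssociativeRing

variable (K : Type v) [Field K] (L : Type u) [LieRing L] [LieAlgebra K L]

local notation "𝒰" => UniversalEnvelopingAlgebra K L

theorem augmentation_ι (x : L) : augmentation K L (UniversalEnvelopingAlgebra.ι K x) = 0 :=
  UniversalEnvelopingAlgebra.lift_ι_apply K _ x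

/-- The augmentation as a map of `𝒰(L)`-modules. -/
noncomputable def augmentationMap : 𝒰 →ₗ[𝒰] TrivialModule K L where
  toFun u := augmentation K L u
  map_add' u v := map_add (augmentation K L) u v
  map_smul' u v := map_mul (augmentation K L) u v

theorem augmentationMap_surjective : Function.Surjective (augmentationMap K L) := fun c =>
  ⟨algebraMap K 𝒰 c, (augmentation K L).commutes c⟩

theorem adjoin_range_ι :
    Algebra.adjoin K (Set.range (UniversalEnvelopingAlgebra.ι K : L → 𝒰)) = ⊤ := by
  rw [eq_top_iff]
  have hs : Function.Surjective (UniversalEnvelopingAlgebra.mkAlgHom K L) :=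
    RingCon.mkₐ_surjective _
  intro u _
  obtain ⟨t, rfl⟩ := hs u
  induction t using TensorAlgebra.induction with
  | algebraMap r => rw [AlgHom.commutes]; exact Subalgebra.algebraMap_mem _ r
  | ι x => exact Algebra.subset_adjoin ⟨x, rfl⟩
  | mul a b ha hb => rw [map_mul]; exact mul_mem (ha trivial) (hb trivial)
  | add a b ha hb => rw [map_add]; exact add_mem (ha trivial) (hb trivial)

theorem ker_augmentationMap :
    LinearMap.ker (augmentationMap K L) =
      Submodule.span 𝒰 (Set.range (UniversalEnvelopingAlgebra.ι K : L → 𝒰)) := by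
  apply le_antisymm
  · have key : ∀ u : 𝒰, u - algebraMap K 𝒰 (augmentation K L u) ∈
        Submodule.span 𝒰 (Set.range (UniversalEnvelopingAlgebra.ι K : L → 𝒰)) := by
      intro u
      have hu : u ∈ Algebra.adjoin K (Set.range (UniversalEnvelopingAlgebra.ι K : L → 𝒰)) := by
        rw [adjoin_range_ι]; trivial
      induction hu using Algebra.adjoin_induction with
      | mem x hx =>
        obtain ⟨y, rfl⟩ := hx
        rw [augmentation_ι, map_zero, sub_zero]
        exact Submodule.subset_span ⟨y, rfl⟩
      | algebraMap r => simp
      | add x y _ _ hx hy =>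
        convert add_mem hx hy using 1
        rw [map_add, map_add]
        abel
      | mul x y _ _ hx hy =>
        convert add_mem (Submodule.smul_mem _ x hy)
          (Submodule.smul_mem _ (algebraMap K 𝒰 (augmentation K L y)) hx) using 1
        rw [map_mul, map_mul, smul_eq_mul, smul_eq_mul, mul_sub, mul_sub,
          Algebra.commutes (augmentation K L y) x, Algebra.commutes (augmentation K L y)]
        abel
    intro u hu
    have := key u
    rwa [show augmentation K L u = 0 from hu, map_zero, sub_zero] at this
  · rw [Submodule.span_le]
    rintro _ ⟨x, rfl⟩
    exact augmentation_ι K L x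

/-- A Lie algebra is finitely generated. -/
def IsFG : Prop := ∃ S : Set L, S.Finite ∧ LieSubalgebra.lieSpan K L S = ⊤

variable {K L}

theorem isFP_of_finite_syzygy (s : ℕ)
    (h : ∀ i, i < s → Module.Finite 𝒰
      (syzygy (ModuleCat.of 𝒰 (LinearMap.ker (augmentationMap K L))) i)) : IsFP K L s :=
  exists_resolution (augmentationMap K L) (augmentationMap_surjective K L) s h

theorem isFP_of_isNoetherianRing [IsNoetherianRing 𝒰] (s : ℕ) : IsFP K L s :=
  isFP_of_finite_syzygy s fun i _ => finite_syzygy _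
    (inferInstanceAs (Module.Finite 𝒰 (LinearMap.ker (augmentationMap K L)))) i

theorem IsFP.mono {s t : ℕ} (h : IsFP K L t) (hst : s ≤ t) : IsFP K L s := by
  obtain ⟨P, i₁, i₂, d, ε, hP, hf, h⟩ := h
  exact ⟨P, i₁, i₂, d, ε, hP, fun i hi => hf i (hi.trans hst), h⟩

/-- Lie generators of `L` generate the augmentation ideal as a left ideal, because `x * y - y * x`
lies in every left ideal containing `x` and `y`. -/
theorem IsFG.isFP_one (h : IsFG K L) : IsFP K L 1 := by
  refine isFP_of_finite_syzygy 1 fun i hi => ?_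
  obtain rfl : i = 0 := by omega
  obtain ⟨S, hS, hSL⟩ := h
  refine Module.Finite.iff_fg.2 ?_
  have : LinearMap.ker (augmentationMap K L) =
      Submodule.span 𝒰 ((UniversalEnvelopingAlgebra.ι K : L → 𝒰) '' S) := by
    rw [ker_augmentationMap]
    apply le_antisymm
    · rw [Submodule.span_le]
      rintro _ ⟨x, rfl⟩
      have hx : x ∈ LieSubalgebra.lieSpan K L S := hSL ▸ LieSubalgebra.mem_top x
      induction hx using LieSubalgebra.lieSpan_induction with
      | mem x hx => exact Submodule.subset_span ⟨x, hx, rfl⟩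
      | zero => simp
      | add x y _ _ hx hy => rw [map_add]; exact add_mem hx hy
      | smul r x _ hx =>
        rw [map_smul, Algebra.smul_def]
        exact Submodule.smul_mem _ (algebraMap K 𝒰 r) hx
      | lie x y _ _ hx hy =>
        rw [LieHom.map_lie, LieRing.of_associative_ring_bracket]
        exact sub_mem (Submodule.smul_mem _ _ hy) (Submodule.smul_mem _ _ hx)
    · exact Submodule.span_mono (Set.image_subset_range _ _)
  rw [this]
  exact Submodule.fg_span (hS.image _)

/-- `FP_1` makes the trivial module finitely presented, so the augmentation ideal is finitely
generated, and finitely many elements of `L` suffice as generators. The subalgebra they generate is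
all of `L` by `mem_of_ι_mem_span`. -/
theorem IsFP.isFG (h : IsFP K L 1) : IsFG K L := by
  obtain ⟨P, i₁, i₂, d, ε, hP, hf, hε, hd, -⟩ := h
  have := hP 0
  have := hf 0 zero_le_one
  have := hf 1 le_rfl
  have : Module.FinitePresentation 𝒰 (P 0) := Module.finitePresentation_of_projective _ _
  have : Module.FinitePresentation 𝒰 (TrivialModule K L) := by
    refine Module.finitePresentation_of_surjective ε hε ?_
    rw [LinearMap.exact_iff.1 hd, LinearMap.range_eq_map]
    exact Submodule.FG.map _ (Module.Finite.fg_top)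
  have hfg := Module.FinitePresentation.fg_ker (augmentationMap K L)
    (augmentationMap_surjective K L)
  rw [ker_augmentationMap, Submodule.fg_span_iff_fg_span_finset_subset] at hfg
  obtain ⟨S', hS', hspan⟩ := hfg
  choose! g hg using fun s (hs : s ∈ (S' : Set 𝒰)) => hS' hs
  refine ⟨g '' S', S'.finite_toSet.image g, ?_⟩
  rw [eq_top_iff]
  intro x _
  apply mem_of_ι_mem_span
  refine Submodule.span_mono ?_ (hspan.le (Submodule.subset_span ⟨x, rfl⟩))
  intro s hs
  exact ⟨g s, LieSubalgebra.subset_lieSpan ⟨s, hs, rfl⟩, hg s hs⟩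

end Augmentation

/-! ### Invariance of the finiteness type under isomorphism. -/

section Transport

attribute [local instance 100] LieRing.ofAssociativeRing

variable {K : Type v} [Field K] {L L' : Type u} [LieRing L] [LieAlgebra K L] [LieRing L']
  [LieAlgebra K L']

/-- The map of universal enveloping algebras induced by a map of Lie algebras. -/
noncomputable def envelopingMap (f : L →ₗ⁅K⁆ L') :
    UniversalEnvelopingAlgebra K L →ₐ[K] UniversalEnvelopingAlgebra K L' :=
  UniversalEnvelopingAlgebra.lift K ((UniversalEnvelopingAlgebra.ι K).comp f)

theorem envelopingMap_ι (f : L →ₗ⁅K⁆ L') (x : L) :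
    envelopingMap f (UniversalEnvelopingAlgebra.ι K x) = UniversalEnvelopingAlgebra.ι K (f x) :=
  UniversalEnvelopingAlgebra.lift_ι_apply K _ x

/-- Isomorphic Lie algebras have isomorphic universal enveloping algebras. -/
noncomputable def envelopingEquiv (e : L ≃ₗ⁅K⁆ L') :
    UniversalEnvelopingAlgebra K L ≃ₐ[K] UniversalEnvelopingAlgebra K L' :=
  AlgEquiv.ofAlgHom (envelopingMap e.toLieHom) (envelopingMap e.symm.toLieHom)
    (by
      apply UniversalEnvelopingAlgebra.hom_ext
      refine LieHom.ext fun x => ?_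
      simp only [LieHom.coe_comp, Function.comp_apply, AlgHom.coe_toLieHom, AlgHom.coe_comp,
        envelopingMap_ι]
      simp)
    (by
      apply UniversalEnvelopingAlgebra.hom_ext
      refine LieHom.ext fun x => ?_
      simp only [LieHom.coe_comp, Function.comp_apply, AlgHom.coe_toLieHom, AlgHom.coe_comp,
        envelopingMap_ι]
      simp)

theorem augmentation_envelopingMap (f : L →ₗ⁅K⁆ L') (u : UniversalEnvelopingAlgebra K L) :
    augmentation K L' (envelopingMap f u) = augmentation K L u := by
  have : (augmentation K L').comp (envelopingMap f) = augmentation K L := by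
    apply UniversalEnvelopingAlgebra.hom_ext
    refine LieHom.ext fun x => ?_
    simp only [LieHom.coe_comp, Function.comp_apply, AlgHom.coe_toLieHom, AlgHom.coe_comp,
      envelopingMap_ι, augmentation_ι]
  exact DFunLike.congr_fun this u

/-- The resolution keeps its underlying groups and maps; only the action is pulled back along the
inverse isomorphism of enveloping algebras. -/
theorem IsFP.of_equiv (e : L ≃ₗ⁅K⁆ L') {s : ℕ} (h : IsFP K L s) : IsFP K L' s := by
  obtain ⟨P, i₁, i₂, d, ε, hP, hf, hε, hd, hd'⟩ := h
  let σ : UniversalEnvelopingAlgebra K L ≃+* UniversalEnvelopingAlgebra K L' :=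
    (envelopingEquiv e).toRingEquiv
  let τ : UniversalEnvelopingAlgebra K L' ≃+* UniversalEnvelopingAlgebra K L := σ.symm
  have := RingHomInvPair.of_ringEquiv σ
  have := RingHomInvPair.of_ringEquiv σ.symm
  let i₃ : ∀ i, Module (UniversalEnvelopingAlgebra K L') (P i) :=
    fun i => Module.compHom (P i) τ.toRingHom
  have hsmul : ∀ i (u : UniversalEnvelopingAlgebra K L') (x : P i), u • x = τ u • x :=
    fun _ _ _ => rfl
  let E : ∀ i, P i ≃ₛₗ[(σ : UniversalEnvelopingAlgebra K L →+* UniversalEnvelopingAlgebra K L')] P i := fun i =>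
    { AddEquiv.refl (P i) with
      map_smul' := fun u x => by
        simp only [hsmul]
        simp [τ] }
  let ε₀ : P 0 → K := ε
  let ε' : P 0 →ₗ[UniversalEnvelopingAlgebra K L'] TrivialModule K L' :=
    { toFun := ε₀
      map_add' := fun x y => ε.map_add x y
      map_smul' := fun u x => by
        have h₁ : ε₀ (τ u • x) = augmentation K L (τ u) * ε₀ x := ε.map_smul (τ u) x
        have h₂ : augmentation K L' (σ (τ u)) = augmentation K L (τ u) :=
          augmentation_envelopingMap e.toLieHom (τ u)
        rw [show σ (τ u) = u from σ.apply_symm_apply u] at h₂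
        rw [hsmul, h₁, ← h₂]
        rfl }
  refine ⟨P, i₁, i₃, fun i => { d i with map_smul' := fun u x => (d i).map_smul (τ u) x }, ε',
    fun i => ?_, fun i hi => ?_, hε, hd, hd'⟩
  · have := hP i
    exact Module.Projective.of_equiv (E i)
  · have := hf i hi
    exact Module.Finite.of_surjective (E i).toLinearMap (E i).surjective

end Transport

/-! ### A Hilbert basis theorem for skew extensions. -/

section Hilbert

variable {A R : Type*} [Ring A] [Ring R] [Module A R]

/-- The `A`-span of the powers of `x` with exponent less than `n`. -/
def powerSpan (A : Type*) {R : Type*} [Ring A] [Ring R] [Module A R] (x : R) (n : ℕ) :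
    Submodule A R :=
  Submodule.span A ((fun i => x ^ i) '' Set.Iio n)

theorem powerSpan_mono (x : R) : Monotone (powerSpan A x) := fun _ _ h =>
  Submodule.span_mono (Set.image_mono (Set.Iio_subset_Iio h))

theorem pow_mem_powerSpan (x : R) {i n : ℕ} (h : i < n) : x ^ i ∈ powerSpan A x n :=
  Submodule.subset_span ⟨i, h, rfl⟩

theorem exists_sub_smul_pow_mem {x r : R} {n : ℕ} (hr : r ∈ powerSpan A x (n + 1)) :
    ∃ a : A, r - a • x ^ n ∈ powerSpan A x n := by
  induction hr using Submodule.span_induction with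
  | mem r hr =>
    obtain ⟨i, hi, rfl⟩ := hr
    rcases Nat.lt_succ_iff_lt_or_eq.1 hi with hi | rfl
    · exact ⟨0, by simpa using pow_mem_powerSpan x hi⟩
    · exact ⟨1, by simp⟩
  | zero => exact ⟨0, by simp⟩
  | add r s _ _ hr hs =>
    obtain ⟨a, ha⟩ := hr
    obtain ⟨b, hb⟩ := hs
    refine ⟨a + b, ?_⟩
    convert add_mem ha hb using 1
    rw [add_smul]
    abel
  | smul c r _ hr =>
    obtain ⟨a, ha⟩ := hr
    refine ⟨c * a, ?_⟩
    convert Submodule.smul_mem _ c ha using 1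
    rw [smul_sub, mul_smul]

theorem mul_mem_powerSpan {x : R}
    (hx : ∀ a : A, ∃ a' : A, ∀ r : R, x * (a • r) = a • (x * r) + a' • r) {r : R} {n : ℕ}
    (hr : r ∈ powerSpan A x n) : x * r ∈ powerSpan A x (n + 1) := by
  induction hr using Submodule.span_induction with
  | mem r hr =>
    obtain ⟨i, hi, rfl⟩ := hr
    simpa only [← pow_succ'] using pow_mem_powerSpan x (Nat.succ_lt_succ hi)
  | zero => simp
  | add r s _ _ hr hs => rw [mul_add]; exact add_mem hr hs
  | smul c r hr' hr =>
    obtain ⟨c', hc'⟩ := hx c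
    rw [hc']
    exact add_mem (Submodule.smul_mem _ _ hr)
      (Submodule.smul_mem _ _ (powerSpan_mono x n.le_succ hr'))

/-- Moving `x` past a coefficient creates only terms of lower degree, so multiplication by `x ^ k`
raises the degree and preserves the leading coefficient. -/
theorem pow_mul_sub_smul_pow_mem {x : R}
    (hx : ∀ a : A, ∃ a' : A, ∀ r : R, x * (a • r) = a • (x * r) + a' • r) {r : R} {a : A} {n : ℕ}
    (hr : r - a • x ^ n ∈ powerSpan A x n) (k : ℕ) :
    x ^ k * r - a • x ^ (n + k) ∈ powerSpan A x (n + k) := by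
  induction k with
  | zero => simpa using hr
  | succ k ih =>
    obtain ⟨a', ha'⟩ := hx a
    rw [← add_assoc n k 1]
    convert add_mem (mul_mem_powerSpan hx ih)
      (Submodule.smul_mem _ a' (pow_mem_powerSpan x (Nat.lt_succ_self (n + k)))) using 1
    rw [mul_sub, ha', ← mul_assoc, ← pow_succ', ← pow_succ']
    abel

/-- The leading coefficients of degree `n` of the elements of a left ideal. -/
def leadingCoeffs (A : Type*) {R : Type*} [Ring A] [Ring R] [Module A R] [IsScalarTower A R R]
    (x : R) (I : Ideal R) (n : ℕ) : Submodule A A :=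
  (I.restrictScalars A ⊔ powerSpan A x n).comap (LinearMap.toSpanSingleton A R (x ^ n))

variable [IsScalarTower A R R]

theorem mem_leadingCoeffs {x : R} {I : Ideal R} {n : ℕ} {a : A} :
    a ∈ leadingCoeffs A x I n ↔ ∃ r ∈ I, r - a • x ^ n ∈ powerSpan A x n := by
  simp only [leadingCoeffs, Submodule.mem_comap, LinearMap.toSpanSingleton_apply,
    Submodule.mem_sup, Submodule.restrictScalars_mem]
  constructor
  · rintro ⟨r, hr, s, hs, h⟩
    exact ⟨r, hr, by rw [← h, sub_add_cancel_left]; exact neg_mem hs⟩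
  · rintro ⟨r, hr, h⟩
    exact ⟨r, hr, _, neg_mem h, by abel⟩

/-- A form of the Hilbert basis theorem: a ring generated by a left noetherian ring `A` and an
element `x` such that commuting with `x` preserves `A` is left noetherian. -/
theorem isNoetherianRing_of_powerSpan [IsNoetherianRing A] {x : R}
    (hx : ∀ a : A, ∃ a' : A, ∀ r : R, x * (a • r) = a • (x * r) + a' • r)
    (hspan : ∀ r : R, ∃ n, r ∈ powerSpan A x n) : IsNoetherianRing R := by
  refine ⟨fun I => ?_⟩
  have hmono : Monotone (leadingCoeffs A x I) := by
    refine monotone_nat_of_le_succ fun n a ha => ?_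
    obtain ⟨r, hr, h⟩ := mem_leadingCoeffs.1 ha
    exact mem_leadingCoeffs.2 ⟨x ^ 1 * r, I.smul_mem (x ^ 1) hr, pow_mul_sub_smul_pow_mem hx h 1⟩
  obtain ⟨N, hN⟩ := monotone_stabilizes_iff_noetherian.2 ‹IsNoetherianRing A›
    ⟨leadingCoeffs A x I, hmono⟩
  have hfin : (powerSpan A x (N + 1)).FG :=
    Submodule.fg_span ((Set.finite_Iio (N + 1)).image _)
  -- All elements of `I` of degree at most `N` are handled at once, as a submodule of a noetherian
  -- `A`-module; no generators of the leading coefficient ideals are needed.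
  have : IsNoetherian A (powerSpan A x (N + 1)) := isNoetherian_of_fg_of_noetherian _ hfin
  obtain ⟨S, hS⟩ : (I.restrictScalars A ⊓ powerSpan A x (N + 1)).FG :=
    isNoetherian_submodule.1 this _ inf_le_right
  have hle : ∀ r ∈ I, r ∈ powerSpan A x (N + 1) → r ∈ Submodule.span R (S : Set R) := by
    intro r hr hr'
    have : r ∈ Submodule.span A (S : Set R) := hS ▸ ⟨hr, hr'⟩
    exact Submodule.span_le_restrictScalars A R _ this
  refine ⟨S, le_antisymm (Submodule.span_le.2 fun r hr => ?_) ?_⟩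
  · exact (hS ▸ Submodule.subset_span hr : r ∈ I.restrictScalars A ⊓ powerSpan A x (N + 1)).1
  have key : ∀ k, ∀ r ∈ I, r ∈ powerSpan A x (N + 1 + k) → r ∈ Submodule.span R (S : Set R) := by
    intro k
    induction k with
    | zero => exact hle
    | succ k ih =>
      intro r hr hr'
      obtain ⟨a, ha⟩ := exists_sub_smul_pow_mem (n := N + 1 + k) hr'
      have haN : a ∈ leadingCoeffs A x I N := by
        have := hN (N + 1 + k) (by omega)
        simp only [OrderHom.coe_mk] at this
        rw [this]
        exact mem_leadingCoeffs.2 ⟨r, hr, ha⟩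
      -- The leading coefficient `a` already occurs in degree `N`, so subtracting `x ^ (1 + k) * s`
      -- lowers the degree of `r`.
      obtain ⟨s, hs, hsa⟩ := mem_leadingCoeffs.1 haN
      have hs' : s ∈ Submodule.span R (S : Set R) := by
        refine hle s hs ?_
        rw [← sub_add_cancel s (a • x ^ N)]
        exact add_mem (powerSpan_mono x N.le_succ hsa)
          (Submodule.smul_mem _ _ (pow_mem_powerSpan x N.lt_succ_self))
      have h := pow_mul_sub_smul_pow_mem hx hsa (1 + k)
      rw [← add_assoc] at h
      have hd := ih (r - x ^ (1 + k) * s) (sub_mem hr (I.smul_mem (x ^ (1 + k)) hs)) (by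
        convert sub_mem ha h using 1
        abel)
      rw [← sub_add_cancel r (x ^ (1 + k) * s)]
      exact add_mem hd (Submodule.smul_mem _ (x ^ (1 + k)) hs')
  intro r hr
  obtain ⟨n, hn⟩ := hspan r
  exact key n r hr (powerSpan_mono x (by omega) hn)

theorem isNoetherianRing_adjoin_insert {K U : Type*} [Field K] [Ring U] [Algebra K U]
    (S : Subalgebra K U) [IsNoetherianRing S] (x : U) (hx : ∀ s ∈ S, x * s - s * x ∈ S) :
    IsNoetherianRing (Algebra.adjoin K (insert x (S : Set U))) := by
  have hle : S ≤ Algebra.adjoin K (insert x (S : Set U)) := fun s hs =>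
    Algebra.subset_adjoin (Set.mem_insert_of_mem _ hs)
  set R := Algebra.adjoin K (insert x (S : Set U)) with hR
  let : Module S R := Module.compHom R (Subalgebra.inclusion hle).toRingHom
  have hsmul : ∀ (s : S) (r : R), ((s • r : R) : U) = s * r := fun _ _ => rfl
  have : IsScalarTower S R R := ⟨fun s r t => Subtype.ext (mul_assoc (s : U) r t)⟩
  let X : R := ⟨x, Algebra.subset_adjoin (Set.mem_insert _ _)⟩
  have hX : ∀ a : S, ∃ a' : S, ∀ r : R, X * (a • r) = a • (X * r) + a' • r := by
    intro a
    refine ⟨⟨_, hx a a.2⟩, fun r => Subtype.ext ?_⟩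
    simp only [MulMemClass.coe_mul, AddMemClass.coe_add, hsmul, X]
    noncomm_ring
  refine isNoetherianRing_of_powerSpan hX fun r => ?_
  -- The elements that multiply every power span into some power span form a subalgebra; the claim
  -- follows by applying this to `1 = X ^ 0`.
  have key : ∀ u (hu : u ∈ R), ∀ n, ∀ g ∈ powerSpan S X n, ∃ m,
      (⟨u, hu⟩ : R) * g ∈ powerSpan S X m := by
    intro u hu
    induction hu using Algebra.adjoin_induction with
    | mem u hu =>
      intro n g hg
      rcases hu with rfl | hu
      · exact ⟨n + 1, mul_mem_powerSpan hX hg⟩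
      · exact ⟨n, Submodule.smul_mem _ (⟨u, hu⟩ : S) hg⟩
    | algebraMap c =>
      intro n g hg
      exact ⟨n, Submodule.smul_mem _ (algebraMap K S c) hg⟩
    | add u v hu' hv' hu hv =>
      intro n g hg
      obtain ⟨m, hm⟩ := hu n g hg
      obtain ⟨m', hm'⟩ := hv n g hg
      refine ⟨max m m', ?_⟩
      convert add_mem (powerSpan_mono X (le_max_left m m') hm)
        (powerSpan_mono X (le_max_right m m') hm') using 1
      exact Subtype.ext (add_mul u v (g : U))
    | mul u v hu' hv' hu hv =>
      intro n g hg
      obtain ⟨m, hm⟩ := hv n g hg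
      obtain ⟨m', hm'⟩ := hu m _ hm
      refine ⟨m', ?_⟩
      convert hm' using 1
      exact Subtype.ext (mul_assoc u v (g : U))
  obtain ⟨m, hm⟩ := key r.1 r.2 1 1 (by simpa using pow_mem_powerSpan (A := S) X zero_lt_one)
  exact ⟨m, by simpa using hm⟩

end Hilbert

/-! ### Enveloping algebras of finite-dimensional nilpotent Lie algebras. -/

section Nilpotent

attribute [local instance 100] LieRing.ofAssociativeRing

variable {K : Type v} [Field K] {L : Type u} [LieRing L] [LieAlgebra K L]

/-- The nonzero nilpotent quotient by `W` has nonzero centre: `x` is taken in the last term of the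
lower central series that is not inside `W`. -/
theorem exists_notMem_lie_mem {r : ℕ} (hr : LieModule.lowerCentralSeries K L L r = ⊥)
    {W : LieIdeal K L} (hW : W ≠ ⊤) : ∃ x, x ∉ W ∧ ∀ y : L, ⁅y, x⁆ ∈ W := by
  classical
  have hex : ∃ t, LieModule.lowerCentralSeries K L L t ≤ W := ⟨r, hr ▸ bot_le⟩
  obtain ⟨t, ht⟩ : ∃ t, Nat.find hex = t + 1 := by
    refine Nat.exists_eq_succ_of_ne_zero fun h0 => hW ?_
    have := Nat.find_spec hex
    rw [h0, LieModule.lowerCentralSeries_zero] at this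
    exact top_le_iff.1 this
  have hnot : ¬ LieModule.lowerCentralSeries K L L t ≤ W := Nat.find_min hex (by omega)
  obtain ⟨x, hx, hxW⟩ := SetLike.not_le_iff_exists.1 hnot
  refine ⟨x, hxW, fun y => ?_⟩
  have := Nat.find_spec hex
  rw [ht, LieModule.lowerCentralSeries_succ] at this
  exact this (LieSubmodule.lie_mem_lie (LieSubmodule.mem_top y) hx)

theorem lie_adjoin_mem {U : Type*} [Ring U] [Algebra K U] {s : Set U} {x : U}
    (h : ∀ y ∈ s, x * y - y * x ∈ Algebra.adjoin K s) {u : U} (hu : u ∈ Algebra.adjoin K s) :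
    x * u - u * x ∈ Algebra.adjoin K s := by
  induction hu using Algebra.adjoin_induction with
  | mem u hu => exact h u hu
  | algebraMap c => simp [Algebra.commutes]
  | add u v _ _ hu hv =>
    convert add_mem hu hv using 1
    noncomm_ring
  | mul u v hu' hv' hu hv =>
    convert add_mem (mul_mem hu hv') (mul_mem hu' hv) using 1
    noncomm_ring

/-- The universal enveloping algebra of a finite-dimensional nilpotent Lie algebra is left
noetherian. -/
theorem isNoetherianRing_universalEnvelopingAlgebra [FiniteDimensional K L] {r : ℕ}
    (hr : LieModule.lowerCentralSeries K L L r = ⊥) :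
    IsNoetherianRing (UniversalEnvelopingAlgebra K L) := by
  let j : L →ₗ⁅K⁆ UniversalEnvelopingAlgebra K L := UniversalEnvelopingAlgebra.ι K
  let B : LieIdeal K L → Subalgebra K (UniversalEnvelopingAlgebra K L) := fun W =>
    Algebra.adjoin K (j '' (W : Set L))
  have hbot : IsNoetherianRing (B ⊥) := by
    have : B ⊥ = ⊥ := by
      rw [eq_bot_iff, Algebra.adjoin_le_iff]
      rintro _ ⟨x, hx, rfl⟩
      obtain rfl : x = 0 := by simpa using hx
      rw [map_zero]
      exact zero_mem _
    rw [this]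
    exact isNoetherianRing_of_surjective K _
      (algebraMap K (⊥ : Subalgebra K (UniversalEnvelopingAlgebra K L)))
      (by rintro ⟨_, c, rfl⟩; exact ⟨c, rfl⟩)
  -- A maximal ideal `W` with noetherian `B W` must be `⊤`: otherwise add a vector `x` that is
  -- central modulo `W`. Commuting with `x` preserves `B W`, so the Hilbert basis argument applies.
  obtain ⟨W, hW, hmax⟩ := (wellFounded_gt (α := LieIdeal K L)).has_min
    {W | IsNoetherianRing (B W)} ⟨⊥, hbot⟩
  have hWtop : W = ⊤ := by
    by_contra hne
    obtain ⟨x, hxW, hx⟩ := exists_notMem_lie_mem hr hne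
    let W' : LieIdeal K L :=
      { W.toSubmodule ⊔ Submodule.span K {x} with
        lie_mem := by
          intro y m hm
          obtain ⟨w, hw, z, hz, rfl⟩ := Submodule.mem_sup.1 hm
          obtain ⟨c, rfl⟩ := Submodule.mem_span_singleton.1 hz
          rw [lie_add, lie_smul]
          exact Submodule.mem_sup_left
            (add_mem (LieSubmodule.lie_mem W hw) (Submodule.smul_mem _ c (hx y))) }
    have hWW' : W ≤ W' := fun w hw => Submodule.mem_sup_left hw
    have hxW' : x ∈ W' := Submodule.mem_sup_right (Submodule.mem_span_singleton_self x)
    refine hmax W' ?_ (lt_of_le_of_ne hWW' fun h => hxW (h ▸ hxW'))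
    have hB : B W' = Algebra.adjoin K (insert (j x) (B W : Set _)) := by
      apply le_antisymm
      · refine Algebra.adjoin_le ?_
        rintro _ ⟨y, hy, rfl⟩
        obtain ⟨w, hw, z, hz, rfl⟩ := Submodule.mem_sup.1 hy
        obtain ⟨c, rfl⟩ := Submodule.mem_span_singleton.1 hz
        rw [map_add, map_smul]
        refine add_mem (Algebra.subset_adjoin (Set.mem_insert_of_mem _
          (Algebra.subset_adjoin ⟨w, hw, rfl⟩))) (Subalgebra.smul_mem _
          (Algebra.subset_adjoin (Set.mem_insert _ _)) c)
      · refine Algebra.adjoin_le (Set.insert_subset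
          (Algebra.subset_adjoin ⟨x, hxW', rfl⟩) (Algebra.adjoin_mono (Set.image_mono hWW')))
    have : IsNoetherianRing (B W) := hW
    change IsNoetherianRing (B W')
    rw [hB]
    refine isNoetherianRing_adjoin_insert (B W) (j x) fun s hs => lie_adjoin_mem ?_ hs
    rintro _ ⟨w, hw, rfl⟩
    rw [← LieRing.of_associative_ring_bracket, ← LieHom.map_lie]
    exact Algebra.subset_adjoin ⟨_, LieSubmodule.lie_mem W hw, rfl⟩
  have hBtop : B W = ⊤ := by
    rw [hWtop, ← adjoin_range_ι K L]
    change Algebra.adjoin K (j '' Set.univ) = _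
    rw [Set.image_univ]
  have : IsNoetherianRing (⊤ : Subalgebra K (UniversalEnvelopingAlgebra K L)) := hBtop ▸ hW
  exact isNoetherianRing_of_ringEquiv _ (Subalgebra.topEquiv (R := K)).toRingEquiv

end Nilpotent

/-! ### Lower central series of finitely generated Lie algebras. -/

section LeftNormed

variable {K L : Type*} [Field K] [LieRing L] [LieAlgebra K L]

/-- The left-normed brackets of length `t + 1` in the elements of `S`. -/
def leftNormed (S : Set L) : ℕ → Set L
  | 0 => S
  | t + 1 => Set.image2 (fun x y => ⁅x, y⁆) S (leftNormed S t)

theorem finite_leftNormed {S : Set L} (hS : S.Finite) (t : ℕ) : (leftNormed S t).Finite := by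
  induction t with
  | zero => exact hS
  | succ t ih => exact hS.image2 _ ih

theorem leftNormed_subset (S : Set L) (t : ℕ) :
    leftNormed S t ⊆ LieModule.lowerCentralSeries K L L t := by
  induction t with
  | zero => simp
  | succ t ih =>
    rintro _ ⟨x, -, y, hy, rfl⟩
    rw [LieModule.lowerCentralSeries_succ]
    exact LieSubmodule.lie_mem_lie (LieSubmodule.mem_top x) (ih hy)

/-- Only brackets of `x` with a left-normed `m` need work; there one inducts on `x` in the
subalgebra generated by `S`, where `⁅⁅x, y⁆, m⁆ = ⁅x, ⁅y, m⁆⁆ - ⁅y, ⁅x, m⁆⁆`. -/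
theorem lowerCentralSeries_le_lieSpan {S : Set L} (hS : LieSubalgebra.lieSpan K L S = ⊤) (t : ℕ) :
    LieModule.lowerCentralSeries K L L t ≤ LieSubmodule.lieSpan K L (leftNormed S t) := by
  have hmem : ∀ x, x ∈ LieSubalgebra.lieSpan K L S := fun x => hS ▸ LieSubalgebra.mem_top x
  induction t with
  | zero =>
    intro x _
    have hx := hmem x
    induction hx using LieSubalgebra.lieSpan_induction with
    | mem x hx => exact LieSubmodule.subset_lieSpan hx
    | zero => exact zero_mem _
    | add x y _ _ hx hy => exact add_mem (hx trivial) (hy trivial)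
    | smul c x _ hx => exact SMulMemClass.smul_mem c (hx trivial)
    | lie x y _ _ _ hy => exact LieSubmodule.lie_mem _ (hy trivial)
  | succ t ih =>
    rw [LieModule.lowerCentralSeries_succ, LieSubmodule.lie_le_iff]
    intro x _ m hm
    have hm' := ih hm
    clear hm
    induction hm' using LieSubmodule.lieSpan_induction generalizing x with
    | zero => simp
    | add m n _ _ hm hn => rw [lie_add]; exact add_mem (hm x trivial) (hn x trivial)
    | smul c m _ hm => rw [lie_smul]; exact SMulMemClass.smul_mem c (hm x trivial)
    | lie y m _ hm => exact LieSubmodule.lie_mem _ (hm y trivial)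
    | mem m hm =>
      have hx := hmem x
      induction hx using LieSubalgebra.lieSpan_induction with
      | mem x hx => exact LieSubmodule.subset_lieSpan ⟨x, hx, m, hm, rfl⟩
      | zero => simp
      | add x y _ _ hx hy => rw [add_lie]; exact add_mem (hx trivial) (hy trivial)
      | smul c x _ hx => rw [smul_lie]; exact SMulMemClass.smul_mem c (hx trivial)
      | lie x y _ _ hx hy =>
        rw [lie_lie]
        exact sub_mem (LieSubmodule.lie_mem _ (hy trivial)) (LieSubmodule.lie_mem _ (hx trivial))

/-- Modulo the next term, each term of the series is spanned linearly by finitely many left-normed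
brackets, since any further bracket falls into the next term. -/
theorem exists_finite_span_sup_lowerCentralSeries (h : IsFG K L) (t : ℕ) :
    ∃ F : Set L, F.Finite ∧
      Submodule.span K F ⊔ (LieModule.lowerCentralSeries K L L t).toSubmodule = ⊤ := by
  obtain ⟨S, hSfin, hS⟩ := h
  induction t with
  | zero => exact ⟨∅, Set.finite_empty, by simp⟩
  | succ t ih =>
    obtain ⟨F, hF, hFt⟩ := ih
    refine ⟨F ∪ leftNormed S t, hF.union (finite_leftNormed hSfin t), ?_⟩
    have hle : (LieModule.lowerCentralSeries K L L t).toSubmodule ≤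
        Submodule.span K (leftNormed S t) ⊔
          (LieModule.lowerCentralSeries K L L (t + 1)).toSubmodule := by
      intro m hm
      have hm' := lowerCentralSeries_le_lieSpan hS t hm
      clear hm
      induction hm' using LieSubmodule.lieSpan_induction with
      | zero => exact zero_mem _
      | add m n _ _ hm hn => exact add_mem hm hn
      | smul c m _ hm => exact Submodule.smul_mem _ c hm
      | mem m hm => exact Submodule.mem_sup_left (Submodule.subset_span hm)
      | lie x m hm _ =>
        refine Submodule.mem_sup_right ?_
        rw [LieModule.lowerCentralSeries_succ]
        exact LieSubmodule.lie_mem_lie (LieSubmodule.mem_top x)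
          (LieSubmodule.lieSpan_le.2 (leftNormed_subset S t) hm)
    rw [Submodule.span_union, sup_assoc, eq_top_iff, ← hFt]
    exact sup_le_sup_left hle _

/-- A quotient of a finitely generated Lie algebra is finitely generated. -/
theorem IsFG.of_surjective {L' : Type*} [LieRing L'] [LieAlgebra K L'] (h : IsFG K L)
    (f : L →ₗ⁅K⁆ L') (hf : Function.Surjective f) : IsFG K L' := by
  obtain ⟨S, hS, hSL⟩ := h
  refine ⟨f '' S, hS.image f, ?_⟩
  rw [eq_top_iff]
  intro y _
  obtain ⟨x, rfl⟩ := hf y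
  have : LieSubalgebra.lieSpan K L S ≤ (LieSubalgebra.lieSpan K L' (f '' S)).comap f :=
    LieSubalgebra.lieSpan_le.2 fun s hs => LieSubalgebra.subset_lieSpan ⟨s, hs, rfl⟩
  exact this (hSL ▸ LieSubalgebra.mem_top x)

/-- A finitely generated nilpotent Lie algebra is finite-dimensional. -/
theorem IsFG.finiteDimensional (h : IsFG K L) {r : ℕ}
    (hr : LieModule.lowerCentralSeries K L L r = ⊥) : FiniteDimensional K L := by
  obtain ⟨F, hF, hFr⟩ := exists_finite_span_sup_lowerCentralSeries h r
  rw [hr, LieSubmodule.bot_toSubmodule, sup_bot_eq] at hFr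
  exact ⟨Submodule.fg_def.2 ⟨F, hF, hFr⟩⟩

/-- A subdirect sum of finitely generated Lie algebras that contains a term of the lower central
series of each summand is finitely generated. -/
theorem isFG_of_subdirect {ι : Type*} [Finite ι] {M : ι → Type*} [∀ i, LieRing (M i)]
    [∀ i, LieAlgebra K (M i)] (p : ∀ i, L →ₗ⁅K⁆ M i) (hinj : ∀ x, (∀ i, p i x = 0) → x = 0)
    (hsurj : ∀ i, Function.Surjective (p i)) (hM : ∀ i, IsFG K (M i)) (r : ℕ)
    (hr : ∀ i, ∀ y ∈ LieModule.lowerCentralSeries K (M i) (M i) r,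
      ∃ x, p i x = y ∧ ∀ j, j ≠ i → p j x = 0) : IsFG K L := by
  classical
  have := Fintype.ofFinite ι
  choose F hFfin hF using fun i => exists_finite_span_sup_lowerCentralSeries (hM i) r
  choose S hSfin hS using hM
  choose g hg using hsurj
  choose! e he he' using hr
  let N : ∀ i, Submodule K (M i) := fun i =>
    (LieModule.lowerCentralSeries K (M i) (M i) r).toSubmodule
  have : ∀ i, Module.Finite K (M i ⧸ N i) := by
    refine fun i => ⟨Submodule.fg_def.2 ⟨(N i).mkQ '' F i, (hFfin i).image _, ?_⟩⟩
    have := congrArg (Submodule.map (N i).mkQ) (hF i)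
    rw [Submodule.map_sup, Submodule.mkQ_map_self, sup_bot_eq, Submodule.map_span,
      Submodule.map_top, Submodule.range_mkQ] at this
    exact this
  let φ : L →ₗ[K] ∀ i, M i ⧸ N i := LinearMap.pi fun i => (N i).mkQ ∘ₗ (p i : L →ₗ[K] M i)
  obtain ⟨F', hF', hF'φ⟩ : ∃ F' : Set L, F'.Finite ∧
      LinearMap.range φ ≤ (Submodule.span K F').map φ := by
    have hfg : (Submodule.span K (Set.range φ)).FG := IsNoetherian.noetherian _
    rw [Submodule.fg_span_iff_fg_span_finset_subset] at hfg
    obtain ⟨s, hs, hspan⟩ := hfg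
    choose! q hq using fun y (hy : y ∈ (s : Set (∀ i, M i ⧸ N i))) => hs hy
    refine ⟨q '' s, s.finite_toSet.image q, ?_⟩
    rw [Submodule.map_span, ← Set.image_comp]
    rintro y hy
    have := hspan.le (Submodule.subset_span hy)
    refine Submodule.span_mono ?_ this
    exact fun z hz => ⟨z, hz, hq z hz⟩
  -- `F'` generates modulo `ker φ`, the `g i` lift generators of each factor, and the `e i` are
  -- supported in one factor and generate the terms `N i` as ideals.
  let T : Set L := F' ∪ ((⋃ i, g i '' S i) ∪ ⋃ i, e i '' leftNormed (S i) r)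
  let G := LieSubalgebra.lieSpan K L T
  have hT : T ⊆ G := LieSubalgebra.subset_lieSpan
  refine ⟨T, hF'.union ((Set.finite_iUnion fun i => (hSfin i).image _).union
    (Set.finite_iUnion fun i => (finite_leftNormed (hSfin i) r).image _)), ?_⟩
  have hGp : ∀ i y, ∃ x ∈ G, p i x = y := by
    intro i y
    have : LieSubalgebra.lieSpan K (M i) (S i) ≤ G.map (p i) := by
      refine LieSubalgebra.lieSpan_le.2 fun s hs => ?_
      exact ⟨g i s, hT (Or.inr (Or.inl (Set.mem_iUnion.2 ⟨i, s, hs, rfl⟩))), hg i s⟩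
    exact this (hS i ▸ LieSubalgebra.mem_top y)
  have hGN : ∀ i, ∀ y ∈ N i, ∃ x ∈ G, p i x = y ∧ ∀ j, j ≠ i → p j x = 0 := by
    intro i y hy
    have hy' := lowerCentralSeries_le_lieSpan (hS i) r hy
    clear hy
    induction hy' using LieSubmodule.lieSpan_induction with
    | zero => exact ⟨0, zero_mem _, by simp⟩
    | add y z _ _ hy hz =>
      obtain ⟨x, hx, hxy, hx0⟩ := hy
      obtain ⟨x', hx', hxz, hx0'⟩ := hz
      exact ⟨x + x', add_mem hx hx', by simp [hxy, hxz], fun j hj => by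
        simp [hx0 j hj, hx0' j hj]⟩
    | smul c y _ hy =>
      obtain ⟨x, hx, hxy, hx0⟩ := hy
      exact ⟨c • x, G.smul_mem c hx, by simp [hxy], fun j hj => by simp [hx0 j hj]⟩
    | lie a y _ hy =>
      obtain ⟨x, hx, hxy, hx0⟩ := hy
      -- Since `x` has only its `i`-th coordinate, any `b ∈ G` lying over `a` realizes the bracket,
      -- whatever its other coordinates.
      obtain ⟨b, hb, hba⟩ := hGp i a
      exact ⟨⁅b, x⁆, G.lie_mem hb hx, by simp [hxy, hba], fun j hj => by simp [hx0 j hj]⟩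
    | mem y hy =>
      have hy' := leftNormed_subset (K := K) (S i) r hy
      exact ⟨e i y, hT (Or.inr (Or.inr (Set.mem_iUnion.2 ⟨i, y, hy, rfl⟩))), he i y hy',
        he' i y hy'⟩
  have hker : ∀ x, φ x = 0 → x ∈ G := by
    intro x hx
    have hxN : ∀ i, p i x ∈ N i := fun i => by
      have := congrFun hx i
      simpa [φ] using this
    choose y hyG hy hy0 using fun i => hGN i (p i x) (hxN i)
    have : x = ∑ i, y i := by
      rw [← sub_eq_zero]
      refine hinj _ fun j => ?_
      rw [map_sub, map_sum, Finset.sum_eq_single j (fun i _ hij => hy0 i j hij.symm) (by simp),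
        hy, sub_self]
    rw [this]
    exact sum_mem fun i _ => hyG i
  rw [eq_top_iff]
  intro x _
  obtain ⟨f, hf, hfx⟩ := hF'φ ⟨x, rfl⟩
  have hfG : f ∈ G :=
    (Submodule.span_le (p := G.toSubmodule)).2 (fun s hs => hT (Or.inl hs)) hf
  rw [← sub_add_cancel x f]
  exact add_mem (hker _ (by rw [map_sub, hfx, sub_self])) hfG

end LeftNormed

/-! ### Quotients, and fibre sums over pushouts. -/

section Quotients

variable {K L T Q : Type*} [Field K] [LieRing L] [LieAlgebra K L] [LieRing T] [LieAlgebra K T]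
  [LieRing Q] [LieAlgebra K Q]

/-- The quotient map of a Lie algebra by an ideal. -/
def quotientMk (I : LieIdeal K L) : L →ₗ⁅K⁆ L ⧸ I where
  toFun := LieSubmodule.Quotient.mk
  map_add' _ _ := rfl
  map_smul' _ _ := rfl
  map_lie' := rfl

theorem quotientMk_surjective (I : LieIdeal K L) : Function.Surjective (quotientMk I) :=
  LieSubmodule.Quotient.surjective_mk' I

theorem quotientMk_eq_zero {I : LieIdeal K L} {x : L} : quotientMk I x = 0 ↔ x ∈ I :=
  LieSubmodule.Quotient.mk_eq_zero I

/-- The map induced on the target of a surjection by a map that vanishes on its kernel. -/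
noncomputable def liftOfSurjective (f : L →ₗ⁅K⁆ T) (hf : Function.Surjective f) (g : L →ₗ⁅K⁆ Q)
    (h : ∀ x, f x = 0 → g x = 0) : T →ₗ⁅K⁆ Q :=
  have key : ∀ {x y}, f x = f y → g x = g y := fun {x y} hxy => by
    rw [← sub_eq_zero, ← map_sub]
    exact h _ (by rw [map_sub, hxy, sub_self])
  have hs := Function.surjInv_eq hf
  { toFun := fun t => g (Function.surjInv hf t)
    map_add' := fun s t => by
      rw [← map_add]
      exact key (by simp [hs])
    map_smul' := fun c t => by
      rw [RingHom.id_apply, ← map_smul]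
      exact key (by simp [hs])
    map_lie' := fun {s t} => by
      rw [← LieHom.map_lie]
      exact key (by simp [hs]) }

theorem liftOfSurjective_apply (f : L →ₗ⁅K⁆ T) (hf : Function.Surjective f) (g : L →ₗ⁅K⁆ Q)
    (h : ∀ x, f x = 0 → g x = 0) (x : L) : liftOfSurjective f hf g h (f x) = g x := by
  rw [← sub_eq_zero]
  refine (map_sub g _ _).symm.trans (h _ ?_)
  rw [map_sub, Function.surjInv_eq hf, sub_self]

/-- Finitely generated nilpotent Lie algebras are of type `FP_s` for all `s`. -/
theorem isFP_of_lowerCentralSeries_eq_bot {K : Type v} [Field K] {L : Type u} [LieRing L]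
    [LieAlgebra K L] (h : IsFG K L) {r : ℕ} (hr : LieModule.lowerCentralSeries K L L r = ⊥)
    (s : ℕ) : IsFP K L s := by
  have := h.finiteDimensional hr
  have := isNoetherianRing_universalEnvelopingAlgebra hr
  exact isFP_of_isNoetherianRing s

theorem lowerCentralSeries_eq_bot_of_surjective (f : L →ₗ⁅K⁆ Q) (hf : Function.Surjective f) {r : ℕ}
    (h : ∀ x ∈ LieModule.lowerCentralSeries K L L r, f x = 0) :
    LieModule.lowerCentralSeries K Q Q r = ⊥ := by
  rw [← LieIdeal.lowerCentralSeries_map_eq r hf, LieIdeal.map_eq_bot_iff]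
  exact fun x hx => f.mem_ker.2 (h x hx)

/-- A Lie algebra with two jointly injective quotients is the fibre sum of the quotients over their
pushout. -/
noncomputable def equivFibreSum {K : Type v} [Field K] {L L₁ L₂ Q : Type u} [LieRing L]
    [LieAlgebra K L] [LieRing L₁] [LieAlgebra K L₁] [LieRing L₂] [LieAlgebra K L₂] [LieRing Q]
    [LieAlgebra K Q] (π₁ : L₁ →ₗ⁅K⁆ Q) (π₂ : L₂ →ₗ⁅K⁆ Q) (f : L →ₗ⁅K⁆ L₁) (g : L →ₗ⁅K⁆ L₂)
    (hfg : ∀ x, π₁ (f x) = π₂ (g x)) (hinj : ∀ x, f x = 0 → g x = 0 → x = 0)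
    (hsurj : ∀ y z, π₁ y = π₂ z → ∃ x, f x = y ∧ g x = z) : L ≃ₗ⁅K⁆ fibreSum π₁ π₂ :=
  LieEquiv.ofBijective
    { toFun := fun x => ⟨(f x, g x), hfg x⟩
      map_add' := fun x y => by ext <;> simp
      map_smul' := fun c x => by ext <;> simp
      map_lie' := fun {x y} => Subtype.ext (Prod.ext (LieHom.map_lie f x y) (LieHom.map_lie g x y)) }
    ⟨by
      refine (injective_iff_map_eq_zero' _).2 fun x => ⟨fun hx => ?_, fun hx => ?_⟩
      · have h := congrArg Subtype.val hx
        exact hinj x (congrArg Prod.fst h) (congrArg Prod.snd h)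
      · rw [hx, map_zero],
    by
      rintro ⟨⟨y, z⟩, h⟩
      obtain ⟨x, rfl, rfl⟩ := hsurj y z h
      exact ⟨x, rfl⟩⟩

end Quotients

/-! ### The double induction. -/

section Induction

variable {K : Type v} [Field K]

/-- The subdirect sums handled by the induction: `L` embeds in `∏ i, M i`, projects onto the product
of any at most `m` factors, and contains the term of index `r` of the lower central series of each
factor. -/
structure IsHighlySubdirect (m r : ℕ) {k : ℕ} {M : Fin k → Type u} [∀ i, LieRing (M i)]
    [∀ i, LieAlgebra K (M i)] {L : Type u} [LieRing L] [LieAlgebra K L]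
    (p : ∀ i, L →ₗ⁅K⁆ M i) : Prop where
  injective : ∀ x, (∀ i, p i x = 0) → x = 0
  -- The bound `≤ m`, instead of equality, keeps the condition meaningful when the induction brings
  -- the number of factors below `m`.
  surjective : ∀ S : Finset (Fin k), S.card ≤ m → ∀ y : ∀ i, M i, ∃ x, ∀ i ∈ S, p i x = y i
  lowerCentralSeries : ∀ i, ∀ y ∈ LieModule.lowerCentralSeries K (M i) (M i) r,
    ∃ x, p i x = y ∧ ∀ j, j ≠ i → p j x = 0

theorem IsHighlySubdirect.surjective_apply {m r k : ℕ} {M : Fin k → Type u} [∀ i, LieRing (M i)]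
    [∀ i, LieAlgebra K (M i)] {L : Type u} [LieRing L] [LieAlgebra K L]
    {p : ∀ i, L →ₗ⁅K⁆ M i} (h : IsHighlySubdirect m r p) (hm : 1 ≤ m) (i : Fin k) :
    Function.Surjective (p i) := by
  classical
  intro y
  obtain ⟨x, hx⟩ := h.surjective {i} (by simpa using hm) (Function.update 0 i y)
  exact ⟨x, by simpa using hx i (by simp)⟩

/-- `I` is the part of `L` inside `M 0`, and `D` is its image there. `L` is the fibre sum of `L ⧸ I`
and `M 0` over `M 0 ⧸ D`; `IHk` treats `L ⧸ I`, `IHm` treats the kernel of `π₁`, and `M 0 ⧸ D` is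
nilpotent. -/
theorem IsHighlySubdirect.isFP_succ {m r k : ℕ} (hm : 1 ≤ m)
    (hconj : HomologicalFibreConjecture.{u, v} K m)
    (IHm : ∀ {M : Fin k → Type u} [∀ i, LieRing (M i)] [∀ i, LieAlgebra K (M i)] {L : Type u}
      [LieRing L] [LieAlgebra K L] {p : ∀ i, L →ₗ⁅K⁆ M i}, IsHighlySubdirect m r p →
      (∀ i, IsFP K (M i) m) → IsFP K L m)
    (IHk : ∀ {M : Fin k → Type u} [∀ i, LieRing (M i)] [∀ i, LieAlgebra K (M i)] {L : Type u}
      [LieRing L] [LieAlgebra K L] {p : ∀ i, L →ₗ⁅K⁆ M i}, IsHighlySubdirect (m + 1) r p →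
      (∀ i, IsFP K (M i) (m + 1)) → IsFP K L (m + 1))
    {M : Fin (k + 1) → Type u} [∀ i, LieRing (M i)] [∀ i, LieAlgebra K (M i)] {L : Type u}
    [LieRing L] [LieAlgebra K L] {p : ∀ i, L →ₗ⁅K⁆ M i} (h : IsHighlySubdirect (m + 1) r p)
    (hM : ∀ i, IsFP K (M i) (m + 1)) : IsFP K L (m + 1) := by
  classical
  have hp0 : Function.Surjective (p 0) := h.surjective_apply (by omega) 0
  let I : LieIdeal K L := ⨅ i : Fin k, (p i.succ).ker
  have hI : ∀ x, x ∈ I ↔ ∀ i : Fin k, p i.succ x = 0 := fun x => by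
    simp [I, LieSubmodule.mem_iInf]
  let f := quotientMk I
  have hf : Function.Surjective f := quotientMk_surjective I
  let D : LieIdeal K (M 0) := I.map (p 0)
  have hD : ∀ y, y ∈ D ↔ ∃ x ∈ I, p 0 x = y := fun y =>
    ⟨fun hy => by
      obtain ⟨x, hx⟩ := LieIdeal.mem_map_of_surjective hp0 hy
      exact ⟨x, x.2, hx⟩,
    fun ⟨x, hx, hxy⟩ => hxy ▸ LieIdeal.mem_map hx⟩
  let π₂ := quotientMk D
  have hπ₂ : Function.Surjective π₂ := quotientMk_surjective D
  let π₁ : (L ⧸ I) →ₗ⁅K⁆ M 0 ⧸ D := liftOfSurjective f hf (π₂.comp (p 0)) fun x hx =>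
    quotientMk_eq_zero.2 ((hD _).2 ⟨x, quotientMk_eq_zero.1 hx, rfl⟩)
  have hπ₁ : ∀ x, π₁ (f x) = π₂ (p 0 x) := liftOfSurjective_apply f hf _ _
  let q : ∀ i : Fin k, (L ⧸ I) →ₗ⁅K⁆ M i.succ := fun i => liftOfSurjective f hf (p i.succ)
    fun x hx => (hI x).1 (quotientMk_eq_zero.1 hx) i
  have hq : ∀ i x, q i (f x) = p i.succ x := fun i => liftOfSurjective_apply f hf _ _
  have hqinj : ∀ t, (∀ i, q i t = 0) → t = 0 := by
    intro t ht
    obtain ⟨x, rfl⟩ := hf t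
    exact quotientMk_eq_zero.2 ((hI x).2 fun i => hq i x ▸ ht i)
  have hT : IsHighlySubdirect (m + 1) r q := by
    refine ⟨hqinj, fun S hS y => ?_, fun i y hy => ?_⟩
    · obtain ⟨x, hx⟩ := h.surjective (S.map (Fin.succEmb k)) (by simpa using hS)
        (Fin.cons 0 y)
      exact ⟨f x, fun i hi => by simpa [hq] using hx i.succ (by simpa using hi)⟩
    · obtain ⟨x, hx, hx0⟩ := h.lowerCentralSeries i.succ y hy
      exact ⟨f x, by rw [hq, hx], fun j hj => by
        rw [hq, hx0 _ (Fin.succ_injective k |>.ne hj)]⟩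
  have hA : IsHighlySubdirect m r (fun i => (q i).comp π₁.ker.incl) := by
    refine ⟨fun t ht => Subtype.ext (hqinj _ ht), fun S hS y => ?_, fun i y hy => ?_⟩
    -- One of the `m + 1` available coordinates is spent on forcing `p 0 x = 0`, which puts `f x` in
    -- the kernel of `π₁`.
    · obtain ⟨x, hx⟩ := h.surjective (insert 0 (S.map (Fin.succEmb k)))
        ((Finset.card_insert_le _ _).trans (by simpa using hS)) (Fin.cons 0 y)
      have hx0 : p 0 x = 0 := by simpa using hx 0 (by simp)
      exact ⟨⟨f x, π₁.mem_ker.2 (by rw [hπ₁, hx0, map_zero])⟩, fun i hi => by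
        simpa [hq] using hx i.succ (by simpa using hi)⟩
    · obtain ⟨x, hx, hx0⟩ := h.lowerCentralSeries i.succ y hy
      refine ⟨⟨f x, π₁.mem_ker.2 ?_⟩, (hq i x).trans hx, fun j hj => ?_⟩
      · rw [hπ₁, hx0 0 (Fin.succ_ne_zero i).symm, map_zero]
      · exact (hq j x).trans (hx0 _ (Fin.succ_injective k |>.ne hj))
  have hQ : IsFP K (M 0 ⧸ D) (m + 2) := by
    refine isFP_of_lowerCentralSeries_eq_bot
      (((hM 0).mono (by omega)).isFG.of_surjective π₂ hπ₂)
      (lowerCentralSeries_eq_bot_of_surjective π₂ hπ₂ (r := r) fun y hy => ?_) _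
    obtain ⟨x, hx, hx0⟩ := h.lowerCentralSeries 0 y hy
    exact quotientMk_eq_zero.2 ((hD y).2 ⟨x, (hI x).2 fun i => hx0 _ (Fin.succ_ne_zero i), hx⟩)
  have hπ₁s : Function.Surjective π₁ := by
    intro z
    obtain ⟨y, rfl⟩ := hπ₂ z
    obtain ⟨x, rfl⟩ := hp0 y
    exact ⟨f x, hπ₁ x⟩
  have hfib := hconj (L ⧸ I) (M 0) (M 0 ⧸ D) π₁ π₂ hπ₁s hπ₂ (IHk hT fun i => hM i.succ) (hM 0)
    (IHm hA fun i => (hM i.succ).mono m.le_succ) hQ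
  refine hfib.of_equiv (equivFibreSum π₁ π₂ f (p 0) hπ₁ (fun x hx hx0 => ?_) ?_).symm
  · exact h.injective x (Fin.cases hx0 ((hI x).1 (quotientMk_eq_zero.1 hx)))
  · intro t z htz
    obtain ⟨x, rfl⟩ := hf t
    rw [hπ₁, ← sub_eq_zero, ← map_sub] at htz
    obtain ⟨w, hw, hwz⟩ := (hD _).1 (quotientMk_eq_zero.1 htz)
    -- The `0`-th coordinates of `x` and `z` differ by an element of `D`; correcting by `w ∈ I` does
    -- not change the class in `L ⧸ I`.
    refine ⟨x - w, ?_, ?_⟩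
    · rw [map_sub, sub_eq_self]
      exact quotientMk_eq_zero.2 hw
    · rw [map_sub, hwz]
      abel

theorem IsHighlySubdirect.isFP {m r : ℕ} (hm : 1 ≤ m)
    (hconj : ∀ n, 1 ≤ n → n + 1 ≤ m → HomologicalFibreConjecture.{u, v} K n) {k : ℕ}
    {M : Fin k → Type u} [∀ i, LieRing (M i)] [∀ i, LieAlgebra K (M i)] {L : Type u}
    [LieRing L] [LieAlgebra K L] {p : ∀ i, L →ₗ⁅K⁆ M i} (h : IsHighlySubdirect m r p)
    (hM : ∀ i, IsFP K (M i) m) : IsFP K L m := by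
  induction m, hm using Nat.le_induction generalizing k L with
  | base =>
    exact (isFG_of_subdirect p h.injective (h.surjective_apply le_rfl) (fun i => (hM i).isFG) r
      h.lowerCentralSeries).isFP_one
  | succ m hm IHm =>
    have IHm := @IHm (fun n hn hnm => hconj n hn (by omega))
    induction k generalizing L with
    | zero =>
      have hbot : LieModule.lowerCentralSeries K L L 0 = ⊥ :=
        (LieSubmodule.eq_bot_iff _).2 fun x _ => h.injective x fun i => i.elim0
      refine isFP_of_lowerCentralSeries_eq_bot ⟨∅, Set.finite_empty, ?_⟩ hbot _
      rw [eq_top_iff]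
      intro x _
      rw [h.injective x fun i => i.elim0]
      exact zero_mem _
    | succ k IHk =>
      exact h.isFP_succ hm (hconj m hm le_rfl) IHm IHk hM

end Induction

/-! ### Lower central series inside a subdirect sum, and the theorem. -/

/-- If `L` projects onto the sum of any two summands, it contains a term of the lower central series
of each summand. -/
theorem exists_of_mem_lowerCentralSeries {K : Type v} [Field K] {k : ℕ} {M : Fin k → Type u}
    [∀ i, LieRing (M i)] [∀ i, LieAlgebra K (M i)] (L : LieSubalgebra K (⨁ i, M i))
    (h : ∀ i j, i ≠ j → ∀ y : M i, ∃ x ∈ L, x i = y ∧ x j = 0) (h₁ : IsSubdirect L) (i : Fin k)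
    (S : Finset (Fin k)) (hS : i ∉ S) {y : M i}
    (hy : y ∈ LieModule.lowerCentralSeries K (M i) (M i) S.card) :
    ∃ x ∈ L, x i = y ∧ ∀ j ∈ S, x j = 0 := by
  induction S using Finset.induction_on generalizing y with
  | empty =>
    obtain ⟨x, hx, hxy⟩ := h₁ i y
    exact ⟨x, hx, hxy, by simp⟩
  | insert j S hj ih =>
    rw [Finset.card_insert_of_notMem hj, LieModule.lowerCentralSeries_succ,
      ← LieSubmodule.mem_toSubmodule, LieSubmodule.lieIdeal_oper_eq_linear_span'] at hy
    simp only [Finset.mem_insert, not_or] at hS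
    induction hy using Submodule.span_induction with
    | zero => exact ⟨0, zero_mem _, by simp⟩
    | add y z _ _ hy hz =>
      obtain ⟨a, ha, hay, ha0⟩ := hy
      obtain ⟨b, hb, hbz, hb0⟩ := hz
      exact ⟨a + b, add_mem ha hb, by simp [hay, hbz], fun l hl => by
        simp [ha0 l hl, hb0 l hl]⟩
    | smul c y _ hy =>
      obtain ⟨a, ha, hay, ha0⟩ := hy
      exact ⟨c • a, L.smul_mem c ha, by simp [hay, DirectSum.smul_apply], fun l hl => by
        simp [ha0 l hl, DirectSum.smul_apply]⟩
    | mem y hy =>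
      obtain ⟨a, -, b, hb, rfl⟩ := hy
      obtain ⟨s, hs, hsa, hs0⟩ := h i j hS.1 a
      obtain ⟨t, ht, htb, ht0⟩ := ih hS.2 hb
      -- `s` vanishes at `j` and `t` vanishes on `S`, so the bracket vanishes on both; each further
      -- coordinate costs one step in the series.
      refine ⟨⁅s, t⁆, L.lie_mem hs ht, by rw [DirectSum.bracket_apply, hsa, htb], fun l hl => ?_⟩
      rw [DirectSum.bracket_apply]
      rcases Finset.mem_insert.1 hl with rfl | hl
      · rw [hs0, zero_lie]
      · rw [ht0 l hl, lie_zero]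

end LieFP

theorem theoremH {K : Type v} [Field K] (m : ℕ) (hm : 2 ≤ m)
    (h : ∀ n : ℕ, 1 ≤ n → n + 1 ≤ m → LieFP.HomologicalFibreConjecture.{u, v} K n) :
    LieFP.HomologicalSurjectionConjecture.{u, v} K m := by
  classical
  intro k hk M _ _ L hsub _ hM hproj
  have hsurj : ∀ S : Finset (Fin k), S.card ≤ m → ∀ y : ∀ i, M i, ∃ x ∈ L, ∀ i ∈ S, x i = y i := by
    intro S hS y
    -- Since `m ≤ k`, a smaller set of indices can be enlarged to exactly `m` of them.
    obtain ⟨S', hSS', hS'⟩ := Finset.exists_superset_card_eq hS (by simpa using hk)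
    obtain ⟨x, hx, hxy⟩ := hproj S' hS' fun i => y i
    exact ⟨x, hx, fun i hi => hxy ⟨i, hSS' hi⟩⟩
  have hpair : ∀ i j, i ≠ j → ∀ y : M i, ∃ x ∈ L, x i = y ∧ x j = 0 := by
    intro i j hij y
    obtain ⟨x, hx, hxy⟩ := hsurj {i, j} (Finset.card_le_two.trans hm) (Function.update 0 i y)
    exact ⟨x, hx, by simpa using hxy i (by simp), by simpa [hij.symm] using hxy j (by simp)⟩
  -- The index `k - 1` is the number of coordinates other than `i` that must be killed.
  refine LieFP.IsHighlySubdirect.isFP (m := m) (r := k - 1) (by omega) h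
    (p := fun i => (DirectSum.lieAlgebraComponent K (Fin k) M i).comp L.incl)
    ⟨fun x hx => ?_, fun S hS y => ?_, fun i y hy => ?_⟩ hM
  · exact Subtype.ext (DFinsupp.ext hx)
  · obtain ⟨x, hx, hxy⟩ := hsurj S hS y
    exact ⟨⟨x, hx⟩, hxy⟩
  · obtain ⟨x, hx, hxy, hx0⟩ := LieFP.exists_of_mem_lowerCentralSeries L hpair hsub i
      (Finset.univ.erase i) (by simp) (y := y) (by simpa using hy)
    exact ⟨⟨x, hx⟩, hxy, fun j hj => hx0 j (by simp [hj])⟩
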